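/- **Theorem 5.2 (Serre's duality).** Let $F$ be a number field with ring of integers $O_F$ and different $\partial$. An Arakelov divisor is a formal sum $D=\sum_P x_P P+\sum_\sigma x_\sigma\sigma$ over the nonzero primes $P$ of $O_F$ and the infinite places $\sigma$ of $F$, with $x_P\in\mathbb Z$ almost all zero and $x_\sigma\in\mathbb R$. Put $I_D=\prod_P P^{-x_P}$, a lattice in $F\otimes\mathbb R=\prod_{\sigma\text{ real}}\mathbb R\times\prod_{\sigma\text{ complex}}\mathbb C$, put $$\|z\|_D^2=\sum_{\sigma\text{ real}}e^{-2x_\sigma}|z_\sigma|^2+\sum_{\sigma\text{ complex}}2e^{-x_\sigma}|z_\sigma|^2\qquad(z\in F\otimes\mathbb R),$$ and $u_D(z)=e^{-\pi\|z\|_D^2}$. The canonical divisor $K$ has $I_K=\partial^{-1}$ and zero infinite coefficients. *Ghost-spaces.* Let $G$ be a locally compact abelian group. For a continuous, strictly positive, positive-definite $u:G\to\mathbb R$ with $u(0)=1$, the ghost-space of the first kind $G_u$ is $G$ with the convolution $\delta_x*\delta_y=\frac{u(x)u(y)}{u(x+y)}\delta_{x+y}$. For a positive-definite even probability measure $\mu$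 on $G$, the ghost-space of the second kind $G^\mu$ is $G$ with the convolution $\delta_x*\delta_y=T_{x+y}\mu$, where $T_z$ is translation by $z$. (A measure $\mu$ is positive-definite if $\int (f*f^\vee)\,d\mu\ge 0$ for all continuous compactly supported $f:G\to\mathbb C$, where $f^\vee(x)=\overline{f(-x)}$.) If $H\subseteq G$ is a closed subgroup with Haar measure $m$, then $G_u/H_u=(G/H)_v$ with $v(x+H)=\int_H u(x+y)\,dm(y)\big/\int_H u(y)\,dm(y)$, provided that the integrals converge and $(G/H)_v$ is a ghost-space of the first kind. If $u$ is integrable for a Haar measure $m$ of $G$, then $G/G_u=G^\mu$ with $\mu$ the probability measure proportional to $u\cdot m$. *Duals.* The dual $\widehat{G_u}$ is the space of symmetric quasi-characters of $G_u$, that is, of nonzero continuous $\varphi:G\to\mathbb C$ with $\varphi(x)\varphi(y)=\int\varphi\,d(\delta_x*\delta_y)$ and $\varphi(-x)=\overline{\varphi(x)}$, with the compact-open topology, the involution $\varphi\mapsto\overline\varphi$, and the convolution for which $\delta_\varphi*\delta_\psi$ is the bounded regular Borel measure $\nu$ such that $\varphi(x)\psi(x)=\int\eta(x)\,d\nu(\eta)$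 for all $x\in G$. Equivalently, through $\chi\mapsto\chi u$, it is $\widehat G^{\,\hat u}$, where $\hat u$ is the bounded regular Borel measure on $\widehat G$ with $u(x)=\int\chi(x)\,d\hat u(\chi)$ for all $x\in G$. *Statement.* Let $D$ be an Arakelov divisor, $I=I_D$, $u=u_D$. Then $I_{K-D}=\partial^{-1}I^{-1}$; the ghost-space of the first kind $H^0(K-D)=(\partial^{-1}I^{-1})_{u_{K-D}}$ is well defined; and all quotients in $$H^1(D)=\big((I\otimes\mathbb R)/I\big)\big/\big((I\otimes\mathbb R)_u/I_u\big)$$ are well defined, so that $H^1(D)=((I\otimes\mathbb R)/I)^\omega$ is a ghost-space of the second kind, where $\omega$ is the probability measure proportional to $\sum_{y\in I}e^{-\pi\|x+y\|_D^2}\cdot m$, with $m$ a Haar measure of $(I\otimes\mathbb R)/I$. Moreover $$H^1(D)=\widehat{H^0(K-D)}$$ as ghost-spaces. Precisely: $\overline x\mapsto\big(y\mapsto e^{2\pi i\,\mathrm{Tr}(xy)}\big)$, where $\mathrm{Tr}$ is the trace of the $\mathbb R$-algebra $F\otimes\mathbb R$, is an isomorphism of topological groups from $(I\otimes\mathbb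 R)/I$ onto the Pontryagin dual of $\partial^{-1}I^{-1}$; it maps $\omega$ to the Fourier transform $\widehat{u_{K-D}}$, which exists and is unique; and $\overline x\mapsto\big(y\mapsto e^{2\pi i\,\mathrm{Tr}(xy)}u_{K-D}(y)\big)$ is a homeomorphism from $(I\otimes\mathbb R)/I$ onto the space of symmetric quasi-characters of $H^0(K-D)$ that carries $-\overline x$ to the complex conjugate and carries the convolution of $H^1(D)$ to the dual convolution, which exists and is unique. -/

import Mathlib

open MeasureTheory NumberField IsDedekindDomain

open scoped nonZeroDivisors

noncomputable section

/-! ### Ghost-spaces -/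

namespace GhostSpace

/-- A convolution of measures on a space `X`, given (as usual for weakly separately continuous
convolutions) by its values `δ_x * δ_y` on pairs of point measures. -/
abbrev Convolution (X : Type*) [MeasurableSpace X] : Type _ := X → X → Measure X

section Groups

variable {G : Type*} [AddCommGroup G] [TopologicalSpace G]

open scoped ComplexOrder in
/-- Positive-definite functions: every matrix `f (x_j - x_i)` is hermitian and
nonnegative-definite. -/
def IsPositiveDefinite (f : G → ℂ) : Prop :=
  ∀ (n : ℕ) (x : Fin n → G), (Matrix.of fun i j => f (x j - x i)).PosSemidef

/-- The functions `u` that define a ghost-space of the first kind `G_u`. -/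
structure IsFirstKind (u : G → ℝ) : Prop where
  continuous : Continuous u
  pos : ∀ x, 0 < u x
  map_zero : u 0 = 1
  positiveDefinite : IsPositiveDefinite fun x => (u x : ℂ)

/-- The convolution of the ghost-space of the first kind `G_u`:
`δ_x * δ_y = (u x * u y / u (x + y)) δ_{x + y}`. -/
def firstKind [MeasurableSpace G] (u : G → ℝ) : Convolution G := fun x y =>
  ENNReal.ofReal (u x * u y / u (x + y)) • Measure.dirac (x + y)

/-- The convolution of the ghost-space of the second kind `G^μ`: `δ_x * δ_y = T_{x + y} μ`. -/
def secondKind [MeasurableSpace G] (μ : Measure G) : Convolution G := fun x y =>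
  μ.map fun z => x + y + z

variable [IsTopologicalAddGroup G] [LocallyCompactSpace G] [MeasurableSpace G] [BorelSpace G]

open scoped ComplexOrder in
/-- Positive-definite measures: `∫ (f * f^∨) dμ ≥ 0` for every continuous compactly supported `f`,
where `f^∨ x` is the complex conjugate of `f (-x)`. -/
def IsPositiveDefiniteMeasure (μ : Measure G) : Prop :=
  ∀ f : G → ℂ, Continuous f → HasCompactSupport f →
    0 ≤ ∫ x, (∫ y, f y * star (f (-(x - y))) ∂(Measure.addHaar : Measure G)) ∂μ

/-- The measures `μ` that define a ghost-space of the second kind `G^μ`. -/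
structure IsSecondKind (μ : Measure G) : Prop where
  probability : IsProbabilityMeasure μ
  even : μ.map (fun x => -x) = μ
  positiveDefinite : IsPositiveDefiniteMeasure μ

/-- `dim_m G_u` is finite. -/
def IsFiniteDimensional (u : G → ℝ) : Prop := Integrable u (Measure.addHaar : Measure G)

/-- The probability measure proportional to `u · m`, where `m` is a Haar measure of `G`. For a
finite-dimensional `G_u`, the quotient `G / G_u` is the ghost-space of the second kind defined by
this measure. -/
def quotientMeasure (u : G → ℝ) : Measure G :=
  ((Measure.addHaar : Measure G).withDensity (fun x => ENNReal.ofReal (u x)) Set.univ)⁻¹ •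
    (Measure.addHaar : Measure G).withDensity fun x => ENNReal.ofReal (u x)

section Quotient

variable (H : AddSubgroup G) [LocallyCompactSpace H]

/-- The function `v` on `G / H` given by
`v (x + H) = (∫_H u (x + y) dm(y)) / (∫_H u y dm(y))`, where `m` is a Haar measure of `H`. -/
def quotientFun (u : G → ℝ) : G ⧸ H → ℝ := fun q =>
  Quotient.liftOn' q
    (fun x => (∫ y : H, u (x + y) ∂(Measure.addHaar : Measure H)) /
      ∫ y : H, u y ∂(Measure.addHaar : Measure H))
    (by
      intro a b hab
      have hab' : -a + b ∈ H := QuotientAddGroup.leftRel_apply.mp hab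
      have h := integral_add_left_eq_self (μ := (Measure.addHaar : Measure H))
        (fun y : H => u (a + y)) ⟨-a + b, hab'⟩
      simp only [AddSubgroup.coe_add] at h
      simp only [← h, add_assoc, add_neg_cancel_left])

/-- The quotient `G_u / H_u` of ghost-spaces of the first kind is defined; it is then the
ghost-space of the first kind `(G / H)_v` for `v = quotientFun H u`. -/
structure HasQuotient (u : G → ℝ) : Prop where
  closed : IsClosed (H : Set G)
  firstKind : IsFirstKind u
  integrable : ∀ x : G, Integrable (fun y : H => u (x + y)) (Measure.addHaar : Measure H)
  quotient : IsFirstKind (quotientFun H u)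

end Quotient

end Groups

/-! ### Duality -/

/-- The Pontryagin dual of an additive topological group, written additively. -/
abbrev AddDual (G : Type*) [AddCommGroup G] [TopologicalSpace G] : Type _ :=
  Additive (PontryaginDual (Multiplicative G))

instance (G : Type*) [AddCommGroup G] [TopologicalSpace G] : MeasurableSpace (AddDual G) :=
  borel _

instance (G : Type*) [AddCommGroup G] [TopologicalSpace G] : BorelSpace (AddDual G) := ⟨rfl⟩

/-- The value `χ x` of a character. -/
def AddDual.eval {G : Type*} [AddCommGroup G] [TopologicalSpace G] (χ : AddDual G) (x : G) : ℂ :=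
  ((Additive.toMul χ) (Multiplicative.ofAdd x) : Circle)

/-- `ν` is the Fourier transform of `u`, that is, the bounded regular Borel measure on the dual
group such that `u x = ∫ χ x dν(χ)` for all `x`. -/
structure IsFourierTransform {G : Type*} [AddCommGroup G] [TopologicalSpace G]
    (u : G → ℝ) (ν : Measure (AddDual G)) : Prop where
  finite : IsFiniteMeasure ν
  regular : ν.Regular
  inversion : ∀ x : G, (u x : ℂ) = ∫ χ : AddDual G, χ.eval x ∂ν

section Dual

variable {X : Type*} [TopologicalSpace X] [MeasurableSpace X] [Neg X]

/-- Symmetric quasi-characters of a convolution: nonzero continuous functions with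
`φ x * φ y = ∫ φ d(δ_x * δ_y)` and `φ (-x) = conj (φ x)`. -/
structure IsSymmetricQuasiCharacter (c : Convolution X) (φ : C(X, ℂ)) : Prop where
  ne_zero : φ ≠ 0
  integrable : ∀ x y, Integrable φ (c x y)
  mul : ∀ x y, φ x * φ y = ∫ z, φ z ∂(c x y)
  symmetric : ∀ x, φ (-x) = star (φ x)

/-- The underlying space of the dual of a convolution: the symmetric quasi-characters, with the
compact-open topology. -/
abbrev QuasiDual (c : Convolution X) : Type _ := {φ : C(X, ℂ) // IsSymmetricQuasiCharacter c φ}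

instance (c : Convolution X) : MeasurableSpace (QuasiDual c) := borel _

instance (c : Convolution X) : BorelSpace (QuasiDual c) := ⟨rfl⟩

/-- `ν` is the convolution `δ_φ * δ_ψ` in the dual: the bounded regular Borel measure whose inverse
Fourier transform is the product of the inverse Fourier transforms of `δ_φ` and `δ_ψ`, that is, of
the functions `φ` and `ψ`. -/
structure IsDualConvolution {c : Convolution X} (φ ψ : QuasiDual c)
    (ν : Measure (QuasiDual c)) : Prop where
  finite : IsFiniteMeasure ν
  regular : ν.Regular
  inversion : ∀ x : X, φ.1 x * ψ.1 x = ∫ η : QuasiDual c, η.1 x ∂ν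

/-- The homeomorphism `Φ` identifies the convolution `d` on `Y` with the Pontryagin dual of the
convolution `c` on `X`: the involution `a ↦ -a` becomes complex conjugation of quasi-characters,
and the image of `δ_a * δ_b` is the one and only dual convolution of `Φ a` and `Φ b`. -/
structure IsDuality {Y : Type*} [TopologicalSpace Y] [MeasurableSpace Y] [Neg Y]
    (c : Convolution X) (d : Convolution Y) (Φ : Y ≃ₜ QuasiDual c) : Prop where
  map_neg : ∀ (a : Y) (x : X), (Φ (-a)).1 x = star ((Φ a).1 x)
  convolution : ∀ (a b : Y) (ν : Measure (QuasiDual c)),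
    IsDualConvolution (Φ a) (Φ b) ν ↔ ν = (d a b).map Φ

end Dual

end GhostSpace

/-! ### Arakelov divisors -/

open GhostSpace

/-- Arakelov divisors of `F`: an integer coefficient for each nonzero prime of the ring of integers,
almost all zero, and a real coefficient for each infinite place. -/
abbrev ArakelovDivisor (F : Type*) [Field F] [NumberField F] : Type _ :=
  (HeightOneSpectrum (𝓞 F) →₀ ℤ) × (InfinitePlace F → ℝ)

namespace ArakelovDivisor

variable {F : Type*} [Field F] [NumberField F]

/-- A nonzero prime as an invertible fractional ideal. -/
def primeUnit (P : HeightOneSpectrum (𝓞 F)) : (FractionalIdeal (𝓞 F)⁰ F)ˣ :=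
  Units.mk0 (P.asIdeal : FractionalIdeal (𝓞 F)⁰ F) (FractionalIdeal.coeIdeal_ne_zero.mpr P.ne_bot)

/-- The fractional ideal `I = ∏ P ^ (-x_P)` associated with a divisor. -/
def ideal (D : ArakelovDivisor F) : (FractionalIdeal (𝓞 F)⁰ F)ˣ :=
  D.1.prod fun P n => primeUnit P ^ (-n)

variable (F) in
/-- The canonical divisor: its coefficient at a prime `P` is the exponent of `P` in the different,
and its infinite coefficients are zero. -/
def canonical : ArakelovDivisor F :=
  (Finsupp.ofSupportFinite
    (fun P => FractionalIdeal.count F P (differentIdeal ℤ (𝓞 F) : FractionalIdeal (𝓞 F)⁰ F))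
    (FractionalIdeal.finite_factors _), 0)

/-- The fractional ideal `I` of `D`, embedded in `F ⊗ ℝ`. The algebra `F ⊗ ℝ = I ⊗ ℝ` is the mixed
space, the product of a copy of `ℝ` for each real place and of `ℂ` for each complex place. -/
def lattice (D : ArakelovDivisor F) : AddSubgroup (mixedEmbedding.mixedSpace F) :=
  (mixedEmbedding.idealLattice F D.ideal).toAddSubgroup

instance (D : ArakelovDivisor F) : DiscreteTopology D.lattice :=
  inferInstanceAs (DiscreteTopology (mixedEmbedding.idealLattice F D.ideal))

instance (D : ArakelovDivisor F) : IsClosed (D.lattice : Set (mixedEmbedding.mixedSpace F)) :=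
  AddSubgroup.isClosed_of_discrete

open scoped Classical in
/-- The hermitian metric `‖z‖²_D` on `F ⊗ ℝ`. -/
def normSq (D : ArakelovDivisor F) (z : mixedEmbedding.mixedSpace F) : ℝ :=
  ∑ w : {w : InfinitePlace F // w.IsReal}, |z.1 w| ^ 2 * Real.exp (-2 * D.2 w) +
    ∑ w : {w : InfinitePlace F // w.IsComplex}, ‖z.2 w‖ ^ 2 * (2 * Real.exp (-D.2 w))

/-- The function `u z = exp (-π ‖z‖²_D)` on `F ⊗ ℝ`. -/
def gaussian (D : ArakelovDivisor F) (z : mixedEmbedding.mixedSpace F) : ℝ :=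
  Real.exp (-Real.pi * D.normSq z)

/-- The restriction of `u` to `I`. -/
def effectivity (D : ArakelovDivisor F) : D.lattice → ℝ := fun y => D.gaussian y

/-- `H⁰(D)` is the ghost-space of the first kind `I_u`. -/
def H0 (D : ArakelovDivisor F) : Convolution D.lattice := firstKind D.effectivity

/-- The function `v` on `(I ⊗ ℝ) / I` with `(I ⊗ ℝ)_u / I_u = ((I ⊗ ℝ) / I)_v`. -/
def quotientGaussian (D : ArakelovDivisor F) : mixedEmbedding.mixedSpace F ⧸ D.lattice → ℝ :=
  quotientFun D.lattice D.gaussian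

/-- The measure `ω` on `(I ⊗ ℝ) / I` that defines the ghost-space
`((I ⊗ ℝ) / I) / ((I ⊗ ℝ)_u / I_u)`. -/
def omega (D : ArakelovDivisor F) : Measure (mixedEmbedding.mixedSpace F ⧸ D.lattice) :=
  quotientMeasure D.quotientGaussian

/-- `H¹(D) = ((I ⊗ ℝ) / I) / ((I ⊗ ℝ)_u / I_u)` is the ghost-space of the second kind
`((I ⊗ ℝ) / I)^ω`. -/
def H1 (D : ArakelovDivisor F) : Convolution (mixedEmbedding.mixedSpace F ⧸ D.lattice) :=
  secondKind D.omega

/-- All quotients of ghost-spaces in the definition of `H¹(D)` exist, and the result is a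
ghost-space of the second kind. -/
structure H1IsDefined (D : ArakelovDivisor F) : Prop where
  hasQuotient : HasQuotient D.lattice D.gaussian
  finiteDimensional : IsFiniteDimensional D.quotientGaussian
  secondKind : IsSecondKind D.omega

/-- The trace pairing `exp (2 π i Tr (x y))` on `F ⊗ ℝ`. -/
def tracePairing (x y : mixedEmbedding.mixedSpace F) : ℂ :=
  Complex.exp (2 * Real.pi * Complex.I * (Algebra.trace ℝ (mixedEmbedding.mixedSpace F) (x * y) : ℝ))

end ArakelovDivisor

end

/-!
Up to a scalar, the Fourier transform of the Gaussian of `D` on `F ⊗ ℝ` is the Gaussian of `K - D`,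
and the dual of the lattice of `D` under the trace form is the lattice of `K - D`, because the
inverse of the different is the trace dual of the ring of integers. Unfolding an integral over the
torus `(I ⊗ ℝ) / I` to one over `F ⊗ ℝ` therefore shows that the Fourier coefficients of `ω` are the
values of the effectivity of `K - D`. These are nonnegative and summable, so the Fourier series of
the density of `ω` converges uniformly and is positive-definite; this makes the quotients
ghost-spaces. On the other side, a symmetric quasi-character of `Γ_u` is `χ u` for a character `χ`
of `Γ`, so the duality of the convolutions is the formula for the Fourier coefficients of `ω`, and
the uniqueness statements hold because a finite measure on a compact group is determined by its
Fourier coefficients.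
-/

noncomputable section

open GhostSpace

namespace GhostSpace

section PositiveDefinite

variable {G : Type*} [AddCommGroup G]

open scoped ComplexOrder in
theorem IsPositiveDefinite.of_map_sub {f : G → ℂ} (a : G → ℂ)
    (h : ∀ x y, f (x - y) = a x * star (a y)) : IsPositiveDefinite f := fun _ x => by
  convert Matrix.posSemidef_vecMulVec_star_self (a ∘ x) using 1
  ext i j
  simp only [Matrix.of_apply, h, Matrix.vecMulVec_apply, Pi.star_apply, Function.comp_apply,
    mul_comm]

open scoped ComplexOrder in
theorem IsPositiveDefinite.const_mul {f : G → ℂ} (hf : IsPositiveDefinite f) {c : ℂ}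
    (hc : 0 ≤ c) : IsPositiveDefinite fun x => c * f x := fun n x => by
  convert (hf n x).smul hc using 1
  ext i j
  simp

open scoped ComplexOrder in
theorem IsPositiveDefinite.integral {α : Type*} [MeasurableSpace α] {μ : Measure α}
    {f : α → G → ℂ} (hf : ∀ s, IsPositiveDefinite (f s))
    (hi : ∀ x, Integrable (fun s => f s x) μ) :
    IsPositiveDefinite fun x => ∫ s, f s x ∂μ := fun n x => by
  refine Matrix.PosSemidef.of_dotProduct_mulVec_nonneg ?_ fun c => ?_
  · ext i j
    simp only [Matrix.conjTranspose_apply, Matrix.of_apply, Complex.star_def, ← integral_conj]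
    exact integral_congr_ae (.of_forall fun s => (hf s n x).1.apply i j)
  · suffices h : star c ⬝ᵥ ((Matrix.of fun i j => ∫ s, f s (x j - x i) ∂μ).mulVec c) =
        ∫ s, star c ⬝ᵥ ((Matrix.of fun i j => f s (x j - x i)).mulVec c) ∂μ by
      rw [h]
      exact integral_nonneg fun s => (hf s n x).dotProduct_mulVec_nonneg c
    have hij (i j : Fin n) : Integrable (fun s => f s (x j - x i) * c j) μ := (hi _).mul_const _
    simp only [dotProduct, Matrix.mulVec, Matrix.of_apply]
    rw [integral_finsetSum _ fun i _ => (integrable_finsetSum _ fun j _ => hij i j).const_mul _]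
    refine Finset.sum_congr rfl fun i _ => ?_
    rw [integral_const_mul, integral_finsetSum _ fun j _ => hij i j]
    simp only [integral_mul_const]

end PositiveDefinite

namespace IsFirstKind

variable {G : Type*} [AddCommGroup G] [TopologicalSpace G] {u : G → ℝ}

theorem map_neg (hu : IsFirstKind u) (x : G) : u (-x) = u x := by
  have h := (hu.positiveDefinite 2 ![0, x]).1.apply 0 1
  simpa using h

theorem coe_ne_zero (hu : IsFirstKind u) (x : G) : (u x : ℂ) ≠ 0 :=
  Complex.ofReal_ne_zero.mpr (hu.pos x).ne'

theorem restrict (hu : IsFirstKind u) (H : AddSubgroup G) : IsFirstKind fun x : H => u x where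
  continuous := hu.continuous.comp continuous_subtype_val
  pos x := hu.pos x
  map_zero := hu.map_zero
  positiveDefinite n x := hu.positiveDefinite n fun i => x i

end IsFirstKind

namespace AddDual

variable {G : Type*} [AddCommGroup G] [TopologicalSpace G]

instance : T2Space (AddDual G) :=
  inferInstanceAs (T2Space (PontryaginDual (Multiplicative G)))

theorem ext_eval {χ ψ : AddDual G} (h : ∀ x, χ.eval x = ψ.eval x) : χ = ψ :=
  PontryaginDual.ext fun a => Subtype.ext (h a)

@[simp]
theorem eval_zero (χ : AddDual G) : χ.eval 0 = 1 := by
  simp [eval]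

theorem eval_add (χ : AddDual G) (x y : G) : χ.eval (x + y) = χ.eval x * χ.eval y := by
  simp [eval]

theorem eval_neg (χ : AddDual G) (x : G) : χ.eval (-x) = star (χ.eval x) := by
  simp only [eval, ofAdd_neg, map_inv, Circle.coe_inv_eq_conj, Complex.star_def]

@[simp]
theorem norm_eval (χ : AddDual G) (x : G) : ‖χ.eval x‖ = 1 :=
  Circle.norm_coe _

@[simp]
theorem add_eval (χ ψ : AddDual G) (x : G) : (χ + ψ).eval x = χ.eval x * ψ.eval x := rfl

@[simp]
theorem zero_eval (x : G) : (0 : AddDual G).eval x = 1 := rfl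

theorem neg_eval (χ : AddDual G) (x : G) : (-χ).eval x = star (χ.eval x) := by
  rw [← eval_neg]
  simp only [eval, ofAdd_neg, map_inv]
  rfl

theorem continuous_eval (χ : AddDual G) : Continuous χ.eval :=
  continuous_subtype_val.comp (map_continuous (Additive.toMul χ))

theorem continuous_eval_const (x : G) : Continuous fun χ : AddDual G => χ.eval x :=
  continuous_subtype_val.comp ((ContinuousEvalConst.continuous_eval_const
    (F := C(Multiplicative G, Circle)) (Multiplicative.ofAdd x)).comp
      (ContinuousMonoidHom.isInducing_toContinuousMap _ _).continuous)

theorem continuous_uncurry_eval [LocallyCompactSpace G] :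
    Continuous fun p : AddDual G × G => p.1.eval p.2 := by
  have : LocallyCompactSpace (Multiplicative G) := inferInstanceAs (LocallyCompactSpace G)
  have h : Continuous fun p : C(Multiplicative G, Circle) × Multiplicative G => p.1 p.2 :=
    ContinuousEval.continuous_eval
  exact continuous_subtype_val.comp (h.comp
    ((ContinuousMonoidHom.isInducing_toContinuousMap _ _).continuous.prodMap continuous_id))

/-- The character of an additive group with the given values. -/
def mk (f : G → Circle) (hf : Continuous f) (h0 : f 0 = 1) (h : ∀ x y, f (x + y) = f x * f y) :
    AddDual G :=
  Additive.ofMul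
    ({ toFun := fun a => f a.toAdd
       map_one' := h0
       map_mul' := fun a b => h a.toAdd b.toAdd
       continuous_toFun := hf } : Multiplicative G →ₜ* Circle)

@[simp]
theorem mk_eval (f : G → Circle) (hf : Continuous f) (h0 : f 0 = 1)
    (h : ∀ x y, f (x + y) = f x * f y) (x : G) : (mk f hf h0 h).eval x = f x := rfl

theorem continuous_of_eval {X : Type*} [TopologicalSpace X] {f : X → AddDual G}
    (h : Continuous fun p : X × G => (f p.1).eval p.2) : Continuous f :=
  ContinuousMonoidHom.continuous_of_continuous_uncurry (B := Multiplicative G) f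
    (Topology.IsInducing.subtypeVal.continuous_iff.mpr h)

end AddDual

/-! ### Quasi-characters of ghost-spaces of the first kind -/

section QuasiCharacters

variable {G : Type*} [AddCommGroup G] [TopologicalSpace G] {u : G → ℝ} [MeasurableSpace G]
  [BorelSpace G] [T1Space G]

theorem integral_firstKind (hu : IsFirstKind u) (φ : G → ℂ) (x y : G) :
    ∫ z, φ z ∂(firstKind u x y) = u x * u y / u (x + y) * φ (x + y) := by
  have h : 0 ≤ u x * u y / u (x + y) :=
    div_nonneg (mul_nonneg (hu.pos x).le (hu.pos y).le) (hu.pos _).le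
  rw [firstKind, integral_smul_measure, integral_dirac, ENNReal.toReal_ofReal h, Complex.real_smul]
  push_cast
  rfl

/-- The quasi-character `χ u` of `G_u` attached to a character `χ` of `G`. -/
def toQuasiDual (hu : IsFirstKind u) (χ : AddDual G) : QuasiDual (firstKind u) where
  val := ⟨fun x => χ.eval x * u x, χ.continuous_eval.mul (by have := hu.continuous; fun_prop)⟩
  property :=
    { ne_zero := fun h => by simpa [hu.map_zero] using DFunLike.congr_fun h 0
      integrable := fun x y =>
        (integrable_dirac enorm_lt_top).smul_measure ENNReal.ofReal_ne_top
      mul := fun x y => by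
        rw [integral_firstKind hu]
        have := hu.coe_ne_zero (x + y)
        simp only [ContinuousMap.coe_mk, AddDual.eval_add]
        field_simp
      symmetric := fun x => by simp [AddDual.eval_neg, hu.map_neg] }

theorem toQuasiDual_injective (hu : IsFirstKind u) : Function.Injective (toQuasiDual hu) := by
  intro χ ψ h
  refine AddDual.ext_eval fun x => mul_right_cancel₀ (hu.coe_ne_zero x) ?_
  exact DFunLike.congr_fun (congrArg Subtype.val h) x

namespace IsSymmetricQuasiCharacter

variable {φ : C(G, ℂ)}

theorem div_map_add (hu : IsFirstKind u) (hφ : IsSymmetricQuasiCharacter (firstKind u) φ)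
    (x y : G) : φ (x + y) / u (x + y) = φ x / u x * (φ y / u y) := by
  have h := hφ.mul x y
  rw [integral_firstKind hu] at h
  have := hu.coe_ne_zero x
  have := hu.coe_ne_zero y
  have := hu.coe_ne_zero (x + y)
  field_simp at h ⊢
  linear_combination -h

theorem div_map_zero (hu : IsFirstKind u) (hφ : IsSymmetricQuasiCharacter (firstKind u) φ) :
    φ 0 / u 0 = 1 := by
  obtain ⟨x, hx⟩ : ∃ x, φ x ≠ 0 := by
    by_contra! h
    exact hφ.ne_zero (ContinuousMap.ext h)
  have h := hφ.div_map_add hu x 0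
  rw [add_zero] at h
  exact (mul_eq_left₀ (div_ne_zero hx (hu.coe_ne_zero x))).mp h.symm

theorem norm_div (hu : IsFirstKind u) (hφ : IsSymmetricQuasiCharacter (firstKind u) φ) (x : G) :
    ‖φ x / u x‖ = 1 := by
  have hneg : φ (-x) / u (-x) = star (φ x / u x) := by
    simp [hφ.symmetric, hu.map_neg]
  have h : star (φ x / u x) * (φ x / u x) = 1 := by
    rw [← hneg, ← hφ.div_map_add hu, neg_add_cancel, hφ.div_map_zero hu]
  have hsq : ‖φ x / u x‖ * ‖φ x / u x‖ = 1 := by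
    rw [← CStarRing.norm_star_mul_self, h, norm_one]
  nlinarith [norm_nonneg (φ x / u x)]

end IsSymmetricQuasiCharacter

theorem toQuasiDual_surjective (hu : IsFirstKind u) : Function.Surjective (toQuasiDual hu) := by
  rintro ⟨φ, hφ⟩
  let c (x : G) : Circle := ⟨φ x / u x, mem_sphere_zero_iff_norm.mpr (hφ.norm_div hu x)⟩
  have hc : Continuous c := by
    refine Continuous.subtype_mk (φ.continuous.div ?_ hu.coe_ne_zero) _
    exact Complex.continuous_ofReal.comp hu.continuous
  refine ⟨AddDual.mk c hc (Subtype.ext (hφ.div_map_zero hu))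
    fun x y => Subtype.ext (hφ.div_map_add hu x y), ?_⟩
  exact Subtype.ext (ContinuousMap.ext fun x => div_mul_cancel₀ _ (hu.coe_ne_zero x))

theorem continuous_toQuasiDual [LocallyCompactSpace G] (hu : IsFirstKind u) :
    Continuous (toQuasiDual hu) := by
  refine Continuous.subtype_mk (ContinuousMap.continuous_of_continuous_uncurry _ ?_) _
  exact AddDual.continuous_uncurry_eval.mul
    (Complex.continuous_ofReal.comp (hu.continuous.comp continuous_snd))

/-- When the dual group is compact, `χ ↦ χ u` is a homeomorphism onto the space of symmetric
quasi-characters. -/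
def quasiDualHomeomorph [LocallyCompactSpace G] [CompactSpace (AddDual G)] (hu : IsFirstKind u) :
    AddDual G ≃ₜ QuasiDual (firstKind u) :=
  Continuous.homeoOfEquivCompactToT2
    (f := Equiv.ofBijective _ ⟨toQuasiDual_injective hu, toQuasiDual_surjective hu⟩)
    (continuous_toQuasiDual hu)

end QuasiCharacters

/-! ### Characters on compact spaces -/

section CompactSpace

variable {X : Type*} [TopologicalSpace X] [CompactSpace X] [MeasurableSpace X] [BorelSpace X]

theorem integrable_of_continuous {E : Type*} [NormedAddCommGroup E]
    [SecondCountableTopologyEither X E] {μ : Measure X} [IsFiniteMeasureOnCompacts μ] {f : X → E}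
    (hf : Continuous f) : Integrable f μ :=
  hf.integrable_of_hasCompactSupport (.of_compactSpace f)

/-- Integration against the complex measure `g · μ`, as a continuous functional on `C(X, ℂ)`. -/
def integralMulCLM (μ : Measure X) [IsFiniteMeasure μ] (g : C(X, ℂ)) : C(X, ℂ) →L[ℂ] ℂ :=
  (L1.integralCLM' ℂ).comp
    ((ContinuousMap.toLp 1 μ ℂ).comp ((ContinuousLinearMap.mul ℂ C(X, ℂ)).flip g))

theorem integralMulCLM_apply (μ : Measure X) [IsFiniteMeasure μ] (g h : C(X, ℂ)) :
    integralMulCLM μ g h = ∫ x, h x * g x ∂μ := by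
  refine (L1.integral_eq' ℂ _).symm.trans ((L1.integral_eq_integral _).trans ?_)
  exact integral_congr_ae (ContinuousMap.coeFn_toLp (𝕜 := ℂ) (p := 1) μ (h * g))

end CompactSpace

namespace AddDual

variable {X Γ : Type*} [TopologicalSpace X] [AddCommGroup Γ] [TopologicalSpace Γ]
  {f : X → AddDual Γ}

/-- The function `x ↦ f x y` for a continuous family `f` of characters of `Γ` and `y : Γ`. When
`X` is itself a group dual to `Γ`, these functions are the characters of `X`. -/
def evalMap (hf : Continuous f) (y : Γ) : C(X, ℂ) :=
  ⟨fun x => (f x).eval y, (continuous_eval_const y).comp hf⟩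

@[simp]
theorem evalMap_apply (hf : Continuous f) (y : Γ) (x : X) : evalMap hf y x = (f x).eval y := rfl

theorem evalMap_zero (hf : Continuous f) : evalMap hf 0 = 1 :=
  ContinuousMap.ext fun x => eval_zero (f x)

theorem evalMap_add (hf : Continuous f) (y z : Γ) :
    evalMap hf (y + z) = evalMap hf y * evalMap hf z :=
  ContinuousMap.ext fun x => eval_add (f x) y z

theorem star_evalMap (hf : Continuous f) (y : Γ) : star (evalMap hf y) = evalMap hf (-y) :=
  ContinuousMap.ext fun x => (eval_neg (f x) y).symm

variable [CompactSpace X]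

theorem norm_evalMap_le (hf : Continuous f) (y : Γ) : ‖evalMap hf y‖ ≤ 1 :=
  (ContinuousMap.norm_le _ zero_le_one).mpr fun x => (norm_eval (f x) y).le

theorem dense_span_range_evalMap (hf : Continuous f) (hinj : Function.Injective f) :
    Dense (Submodule.span ℂ (Set.range (evalMap hf)) : Set C(X, ℂ)) := by
  let S : Submonoid C(X, ℂ) :=
    { carrier := Set.range (evalMap hf)
      one_mem' := ⟨0, evalMap_zero hf⟩
      mul_mem' := by
        rintro _ _ ⟨y, rfl⟩ ⟨z, rfl⟩
        exact ⟨y + z, evalMap_add hf y z⟩ }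
  have hstar : star (S : Set C(X, ℂ)) ⊆ S := by
    rintro g ⟨y, hy⟩
    exact ⟨-y, by rw [← star_evalMap, hy, star_star]⟩
  let A : StarSubalgebra ℂ C(X, ℂ) := StarAlgebra.adjoin ℂ (S : Set C(X, ℂ))
  have hA : Subalgebra.toSubmodule A.toSubalgebra = Submodule.span ℂ (S : Set C(X, ℂ)) := by
    rw [StarAlgebra.adjoin_toSubalgebra, Set.union_eq_self_of_subset_right hstar,
      Algebra.adjoin_eq_span, Submonoid.closure_eq]
  have hsep : A.SeparatesPoints := by
    intro x x' hx
    obtain ⟨y, hy⟩ : ∃ y, (f x).eval y ≠ (f x').eval y := by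
      by_contra! h
      exact hx (hinj (ext_eval h))
    exact ⟨_, ⟨evalMap hf y, StarAlgebra.subset_adjoin ℂ _ ⟨y, rfl⟩, rfl⟩, hy⟩
  have hdense := ContinuousMap.starSubalgebra_topologicalClosure_eq_top_of_separatesPoints A hsep
  change Dense (Submodule.span ℂ (S : Set C(X, ℂ)) : Set C(X, ℂ))
  rw [← hA, dense_iff_closure_eq]
  exact congrArg (SetLike.coe : StarSubalgebra ℂ C(X, ℂ) → Set C(X, ℂ)) hdense

variable [MeasurableSpace X] [BorelSpace X]

theorem measure_ext_of_integral_eval_eq [HasOuterApproxClosed X] (hf : Continuous f)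
    (hinj : Function.Injective f) {P Q : Measure X} [IsFiniteMeasure P] [IsFiniteMeasure Q]
    (h : ∀ y, ∫ x, (f x).eval y ∂P = ∫ x, (f x).eval y ∂Q) : P = Q := by
  have hPQ : integralMulCLM P 1 = integralMulCLM Q 1 := by
    refine ContinuousLinearMap.ext_on (dense_span_range_evalMap hf hinj) ?_
    rintro _ ⟨y, rfl⟩
    simpa only [integralMulCLM_apply, evalMap_apply, ContinuousMap.one_apply, mul_one] using h y
  refine ext_of_forall_integral_eq_of_IsFiniteMeasure fun g => Complex.ofReal_injective ?_
  have hg := DFunLike.congr_fun hPQ ⟨fun x => g x, Complex.continuous_ofReal.comp g.continuous⟩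
  simpa only [integralMulCLM_apply, ContinuousMap.coe_mk, ContinuousMap.one_apply, mul_one,
    integral_complex_ofReal] using hg

theorem eq_zero_of_integralMulCLM_evalMap_eq_zero (hf : Continuous f) (hinj : Function.Injective f)
    (μ : Measure X) [IsFiniteMeasure μ] [μ.IsOpenPosMeasure] {g : C(X, ℂ)}
    (h : ∀ y, integralMulCLM μ (evalMap hf y) g = 0) : g = 0 := by
  have hT : integralMulCLM μ g = 0 := by
    refine ContinuousLinearMap.ext_on (dense_span_range_evalMap hf hinj) ?_
    rintro _ ⟨y, rfl⟩
    simpa only [integralMulCLM_apply, mul_comm, _root_.zero_apply] using h y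
  have hsq : ∫ x, ‖g x‖ ^ 2 ∂μ = 0 := by
    have := DFunLike.congr_fun hT (star g)
    simp only [integralMulCLM_apply, ContinuousMap.star_apply, Complex.star_def,
      Complex.conj_mul', _root_.zero_apply] at this
    exact_mod_cast this
  have hcont : Continuous fun x => ‖g x‖ ^ 2 := by fun_prop
  rw [integral_eq_zero_iff_of_nonneg (fun x => by positivity) (integrable_of_continuous hcont)]
    at hsq
  ext x
  have hx : ‖g x‖ ^ 2 = 0 := congrFun ((hcont.ae_eq_iff_eq μ continuous_zero).mp hsq) x
  exact norm_eq_zero.mp (pow_eq_zero_iff two_ne_zero |>.mp hx)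

end AddDual

/-! ### Fourier series on a compact group -/

namespace AddDual

variable {G Γ : Type*} [AddCommGroup G] [TopologicalSpace G] [IsTopologicalAddGroup G]
  [MeasurableSpace G] [BorelSpace G] [AddCommGroup Γ] [TopologicalSpace Γ]
  (e : G ≃ₜ+ AddDual Γ)

theorem integral_eval_eq_zero (μ : Measure G) [μ.IsAddLeftInvariant] {y : Γ}
    (hy : ∃ a, (e a).eval y ≠ 1) : ∫ a, (e a).eval y ∂μ = 0 := by
  obtain ⟨b, hb⟩ := hy
  have h := integral_add_left_eq_self (μ := μ) (fun a => (e a).eval y) b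
  simp only [map_add, add_eval] at h
  rw [integral_const_mul] at h
  exact (mul_left_eq_self₀.mp h).resolve_left hb

theorem hasSum_fourier [CompactSpace G] (μ : Measure G) [μ.IsAddHaarMeasure]
    (hsep : ∀ y ≠ 0, ∃ a, (e a).eval y ≠ 1) {g : C(G, ℂ)} {c : Γ → ℂ} (hc : Summable c)
    (hg : ∀ y, ⨍ a, (e a).eval (-y) * g a ∂μ = c y) :
    HasSum (fun y => c y • evalMap (f := e) e.continuous y) g := by
  classical
  have hsum : Summable fun y => c y • evalMap (f := e) e.continuous y := by
    refine .of_norm_bounded hc.norm fun y => ?_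
    rw [norm_smul]
    exact mul_le_of_le_one_right (norm_nonneg _) (norm_evalMap_le _ y)
  suffices h : (∑' y, c y • evalMap (f := e) e.continuous y) - g = 0 by
    rw [← sub_eq_zero.mp h]
    exact hsum.hasSum
  refine eq_zero_of_integralMulCLM_evalMap_eq_zero e.continuous e.injective μ fun z => ?_
  have horth (y : Γ) : integralMulCLM μ (evalMap (f := e) e.continuous z)
      (evalMap (f := e) e.continuous y) = if y = -z then (μ.real Set.univ : ℂ) else 0 := by
    simp only [integralMulCLM_apply, evalMap_apply, ← eval_add]
    split_ifs with hy
    · simp [hy]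
    · exact integral_eval_eq_zero e μ (hsep _ fun h => hy (eq_neg_of_add_eq_zero_left h))
  have hcoeff : integralMulCLM μ (evalMap (f := e) e.continuous z) g =
      μ.real Set.univ * c (-z) := by
    rw [← hg, neg_neg, ← Complex.real_smul, measure_smul_average, integralMulCLM_apply]
    simp only [evalMap_apply, mul_comm]
  rw [map_sub, ContinuousLinearMap.map_tsum _ hsum]
  simp only [map_smul, horth, hcoeff, smul_eq_mul, mul_ite, mul_zero, tsum_ite_eq]
  rw [mul_comm, sub_self]

end AddDual

section QuotientMeasure

variable {G : Type*} [AddCommGroup G] [TopologicalSpace G] [IsTopologicalAddGroup G]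
  [CompactSpace G] [MeasurableSpace G] [BorelSpace G] {v : G → ℝ}

theorem integral_addHaar_pos (hv : Continuous v) (hpos : ∀ x, 0 < v x) :
    0 < ∫ x, v x ∂(Measure.addHaar : Measure G) :=
  hv.integral_pos_of_hasCompactSupport_nonneg_nonzero (.of_compactSpace v)
    (fun x => (hpos x).le) (hpos 0).ne'

theorem withDensity_univ_eq_ofReal_integral (hv : Continuous v) (hpos : ∀ x, 0 < v x) :
    (Measure.addHaar : Measure G).withDensity (fun x => ENNReal.ofReal (v x)) Set.univ =
      ENNReal.ofReal (∫ x, v x ∂Measure.addHaar) := by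
  rw [withDensity_apply _ MeasurableSet.univ, Measure.restrict_univ,
    ofReal_integral_eq_lintegral_ofReal (integrable_of_continuous hv)
      (.of_forall fun x => (hpos x).le)]

theorem isProbabilityMeasure_quotientMeasure (hv : Continuous v) (hpos : ∀ x, 0 < v x) :
    IsProbabilityMeasure (quotientMeasure v) where
  measure_univ := by
    rw [quotientMeasure, Measure.smul_apply, withDensity_univ_eq_ofReal_integral hv hpos,
      smul_eq_mul]
    exact ENNReal.inv_mul_cancel
      (ENNReal.ofReal_pos.mpr (integral_addHaar_pos hv hpos)).ne' ENNReal.ofReal_ne_top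

theorem integral_quotientMeasure (hv : Continuous v) (hpos : ∀ x, 0 < v x) (g : G → ℂ) :
    ∫ x, g x ∂(quotientMeasure v) =
      (∫ x, g x * v x ∂Measure.addHaar) / (∫ x, v x ∂Measure.addHaar : ℝ) := by
  rw [quotientMeasure, integral_smul_measure, withDensity_univ_eq_ofReal_integral hv hpos,
    ENNReal.toReal_inv, ENNReal.toReal_ofReal (integral_addHaar_pos hv hpos).le,
    integral_withDensity_eq_integral_toReal_smul (by fun_prop)
      (.of_forall fun _ => ENNReal.ofReal_lt_top), Complex.real_smul, Complex.ofReal_inv,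
    div_eq_inv_mul]
  simp only [ENNReal.toReal_ofReal (hpos _).le, Complex.real_smul, mul_comm]

theorem map_neg_quotientMeasure (hv : Continuous v) (heven : ∀ x, v (-x) = v x) :
    (quotientMeasure v).map (fun x => -x) = quotientMeasure v := by
  rw [quotientMeasure, Measure.map_smul]
  congr 1
  ext s hs
  rw [Measure.map_apply measurable_neg hs, withDensity_apply _ (measurable_neg hs),
    withDensity_apply _ hs, ← (Measure.measurePreserving_neg
      (Measure.addHaar : Measure G)).setLIntegral_comp_preimage hs (by fun_prop)]
  simp only [heven, Set.neg_preimage]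

end QuotientMeasure

/-! ### Functions with nonnegative Fourier coefficients -/

open scoped ComplexOrder in
theorem IsPositiveDefinite.hasSum {ι G : Type*} [AddCommGroup G] {f : ι → G → ℂ} {g : G → ℂ}
    (hf : ∀ i, IsPositiveDefinite (f i)) (hg : ∀ x, HasSum (fun i => f i x) (g x)) :
    IsPositiveDefinite g := fun n x => by
  refine Matrix.PosSemidef.of_dotProduct_mulVec_nonneg ?_ fun c => ?_
  · ext j k
    refine ((hg (x j - x k)).star.congr_fun fun i => ?_).unique (hg (x k - x j))
    exact ((hf i n x).1.apply j k).symm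
  · refine HasSum.nonneg (L := .unconditional ι) (fun i => (hf i n x).dotProduct_mulVec_nonneg c) ?_
    exact hasSum_sum fun j _ => (hasSum_sum fun k _ => (hg _).mul_right _).mul_left _

section Fourier

open AddDual

variable {G Γ : Type*} [AddCommGroup G] [TopologicalSpace G] [AddCommGroup Γ]
  [TopologicalSpace Γ] (e : G ≃ₜ+ AddDual Γ) {v : G → ℝ} {c : Γ → ℝ}

theorem isFirstKind_of_hasSum (hpos : ∀ x, 0 < v x) (h0 : v 0 = 1) (hv : Continuous v)
    (hc : ∀ y, 0 ≤ c y)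
    (h : ∀ x, HasSum (fun y => c y * (e x).eval y) (v x)) : IsFirstKind v where
  continuous := hv
  pos := hpos
  map_zero := h0
  positiveDefinite := by
    refine .hasSum (fun y => ?_) h
    refine .const_mul (.of_map_sub (fun x => (e x).eval y) fun x x' => ?_)
      (Complex.zero_le_real.mpr (hc y))
    rw [sub_eq_add_neg, map_add, map_neg, add_eval, neg_eval]

variable [IsTopologicalAddGroup G] [CompactSpace G] [MeasurableSpace G] [BorelSpace G]

theorem integral_convolution_star_mul_eval (μ : Measure G) [μ.IsAddHaarMeasure] {f : G → ℂ}
    (hf : Continuous f) (y : Γ) :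
    ∫ x, (∫ t, f t * star (f (-(x - t))) ∂μ) * (e x).eval y ∂μ =
      (‖∫ x, f x * (e x).eval y ∂μ‖ ^ 2 : ℝ) := by
  have hχ : Continuous fun x => (e x).eval y := (continuous_eval_const y).comp e.continuous
  have inner (t : G) : ∫ x, star (f (-(x - t))) * (e x).eval y ∂μ =
      (e t).eval y * star (∫ x, f x * (e x).eval y ∂μ) := by
    rw [Complex.star_def, ← integral_conj, ← integral_const_mul, ← integral_sub_left_eq_self _ μ t]
    refine integral_congr_ae (.of_forall fun x => ?_)
    simp only [sub_sub_cancel_left, neg_neg]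
    rw [sub_eq_add_neg, map_add, map_neg, add_eval, neg_eval, map_mul, Complex.star_def]
    ring
  calc ∫ x, (∫ t, f t * star (f (-(x - t))) ∂μ) * (e x).eval y ∂μ
      = ∫ x, ∫ t, f t * (star (f (-(x - t))) * (e x).eval y) ∂μ ∂μ := by
        simp only [← integral_mul_const, mul_assoc]
    _ = ∫ t, ∫ x, f t * (star (f (-(x - t))) * (e x).eval y) ∂μ ∂μ :=
        integral_integral_swap_of_hasCompactSupport
          (((hf.comp continuous_snd).mul ((by fun_prop : Continuous fun p : G × G =>
            star (f (-(p.1 - p.2)))).mul (hχ.comp continuous_fst)))) (.of_compactSpace _)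
    _ = (∫ t, f t * (e t).eval y ∂μ) * star (∫ x, f x * (e x).eval y ∂μ) := by
        simp only [integral_const_mul, inner]
        simp only [← mul_assoc, integral_mul_const]
    _ = _ := by rw [Complex.star_def, Complex.mul_conj, Complex.normSq_eq_norm_sq]

open scoped ComplexOrder in
theorem isSecondKind_quotientMeasure [FirstCountableTopology G] (hv : IsFirstKind v)
    (hc : ∀ y, 0 ≤ c y) {g : C(G, ℂ)} (hg : ∀ x, g x = v x)
    (h : HasSum (fun y => (c y : ℂ) • evalMap (f := e) e.continuous y) g) :
    IsSecondKind (quotientMeasure v) where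
  probability := isProbabilityMeasure_quotientMeasure hv.continuous hv.pos
  even := map_neg_quotientMeasure hv.continuous hv.map_neg
  positiveDefinite f hf _ := by
    set μ : Measure G := Measure.addHaar
    have hconv : Continuous fun x => ∫ t, f t * star (f (-(x - t))) ∂μ := by
      have := continuous_parametric_integral_of_continuous (μ := μ)
        (f := fun x t => f t * star (f (-(x - t)))) (by fun_prop) (isCompact_univ (X := G))
      simpa only [Measure.restrict_univ] using this
    have hsum := h.mapL (integralMulCLM μ ⟨_, hconv⟩)
    rw [integral_quotientMeasure hv.continuous hv.pos]
    refine div_nonneg ?_ (Complex.zero_le_real.mpr (integral_addHaar_pos hv.continuous hv.pos).le)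
    simp only [← hg, mul_comm _ (g _)]
    refine (hsum.nonneg fun y => ?_).trans_eq (integralMulCLM_apply _ _ _)
    rw [map_smul, integralMulCLM_apply]
    refine mul_nonneg (Complex.zero_le_real.mpr (hc y)) ?_
    simp only [evalMap_apply, ContinuousMap.coe_mk, mul_comm ((e _).eval y)]
    refine (Complex.zero_le_real.mpr (sq_nonneg _)).trans_eq
      (integral_convolution_star_mul_eval e μ hf y).symm

end Fourier

end GhostSpace

/-! ### Duality between a ghost-space of each kind -/

namespace GhostSpace

open AddDual

section Duality

variable {G Γ : Type*} [AddCommGroup G] [TopologicalSpace G] [CompactSpace G] [AddCommGroup Γ]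
  [TopologicalSpace Γ] (e : G ≃ₜ+ AddDual Γ) {u : Γ → ℝ}

section Homeomorph

variable [LocallyCompactSpace Γ] [T1Space Γ] [MeasurableSpace Γ] [BorelSpace Γ]

/-- The homeomorphism `a ↦ (e a) u` from `G` onto the space of symmetric quasi-characters of `Γ_u`
induced by an identification `e` of the compact group `G` with the dual of `Γ`. -/
def dualHomeomorph (hu : IsFirstKind u) : G ≃ₜ QuasiDual (firstKind u) :=
  have : CompactSpace (AddDual Γ) := e.toHomeomorph.compactSpace
  e.toHomeomorph.trans (quasiDualHomeomorph hu)

theorem dualHomeomorph_apply (hu : IsFirstKind u) (a : G) (y : Γ) :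
    (dualHomeomorph e hu a).1 y = (e a).eval y * u y := rfl

end Homeomorph

variable [T2Space G] [SecondCountableTopology G] [MeasurableSpace G] [BorelSpace G]

theorem eq_map_iff_forall_integral_eq {Y : Type*} [TopologicalSpace Y] [MeasurableSpace Y]
    [BorelSpace Y] (Φ : G ≃ₜ Y) {k : Γ → Y → ℂ} {u : Γ → ℂ} (hu : ∀ y, u y ≠ 0)
    (hk : ∀ y a, k y (Φ a) = (e a).eval y * u y) (P : Measure G) [IsFiniteMeasure P]
    (ν : Measure Y) : ν = P.map Φ ↔
      IsFiniteMeasure ν ∧ ν.Regular ∧ ∀ y, ∫ η, k y η ∂ν = (∫ a, (e a).eval y ∂P) * u y := by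
  have hmap (Q : Measure G) (y : Γ) :
      ∫ η, k y η ∂(Q.map Φ) = (∫ a, (e a).eval y ∂Q) * u y := by
    rw [Φ.measurableEmbedding.integral_map]
    simp only [hk, integral_mul_const]
  constructor
  · rintro rfl
    exact ⟨Measure.isFiniteMeasure_map P Φ, Measure.Regular.map Φ, hmap P⟩
  · rintro ⟨hfin, -, h⟩
    have hν : (ν.map Φ.symm).map Φ = ν := Φ.toMeasurableEquiv.map_map_symm
    rw [← hν]
    congr 1
    refine measure_ext_of_integral_eval_eq e.continuous e.injective fun y =>
      mul_right_cancel₀ (hu y) ?_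
    exact (hmap _ y).symm.trans (hν.symm ▸ h y)

variable {ω : Measure G} [IsFiniteMeasure ω]

theorem isFourierTransform_iff_eq_map (hω : ∀ y, ∫ a, (e a).eval y ∂ω = u y)
    (ν : Measure (AddDual Γ)) : IsFourierTransform u ν ↔ ν = ω.map e := by
  refine Iff.trans ?_ (eq_map_iff_forall_integral_eq e e.toHomeomorph
    (k := fun y χ => χ.eval y) (u := 1) (fun _ => one_ne_zero)
    (fun y a => (mul_one _).symm) ω ν).symm
  simp only [hω, Pi.one_apply, mul_one]
  exact ⟨fun h => ⟨h.1, h.2, fun y => (h.3 y).symm⟩, fun h => ⟨h.1, h.2.1, fun y => (h.2.2 y).symm⟩⟩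

theorem isDuality_dualHomeomorph [IsTopologicalAddGroup G] [LocallyCompactSpace Γ] [T1Space Γ]
    [MeasurableSpace Γ] [BorelSpace Γ] (hu : IsFirstKind u)
    (hω : ∀ y, ∫ a, (e a).eval y ∂ω = u y) :
    IsDuality (firstKind u) (secondKind ω) (dualHomeomorph e hu) where
  map_neg a y := by
    simp only [dualHomeomorph_apply, map_neg, neg_eval, star_mul', Complex.star_def,
      Complex.conj_ofReal]
  convolution a b ν := by
    have : IsFiniteMeasure (secondKind ω a b) := Measure.isFiniteMeasure_map _ _
    have hconv (y : Γ) : (∫ z, (e z).eval y ∂(secondKind ω a b)) * u y =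
        (dualHomeomorph e hu a).1 y * (dualHomeomorph e hu b).1 y := by
      have htrans : ∫ z, (e z).eval y ∂(secondKind ω a b) = ∫ z, (e (a + b + z)).eval y ∂ω :=
        (Homeomorph.addLeft (a + b)).measurableEmbedding.integral_map _
      simp only [htrans, map_add, add_eval, integral_const_mul, hω, dualHomeomorph_apply]
      ring
    refine Iff.trans ?_ (eq_map_iff_forall_integral_eq e (dualHomeomorph e hu)
      (k := fun y η => η.1 y) hu.coe_ne_zero (fun y c => rfl) (secondKind ω a b) ν).symm
    simp only [hconv]
    exact ⟨fun h => ⟨h.1, h.2, fun y => (h.3 y).symm⟩,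
      fun h => ⟨h.1, h.2.1, fun y => (h.2.2 y).symm⟩⟩

end Duality

end GhostSpace

/-! ### Periodization over a lattice -/

attribute [local instance] AddSubgroup.isClosed_of_discrete

/-- Continuous functions dominated by a power of `1 + ‖x‖` with exponent below `-dim V`. They are
integrable, and summable over every discrete subgroup, locally uniformly under translation. -/
structure HasPolynomialDecay {V : Type*} [NormedAddCommGroup V] [NormedSpace ℝ V] (u : V → ℝ) :
    Prop where
  continuous : Continuous u
  exists_norm_le : ∃ C r : ℝ, Module.finrank ℝ V < r ∧ ∀ x, ‖u x‖ ≤ C * (1 + ‖x‖) ^ (-r)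

section Lattice

variable {V : Type*} [NormedAddCommGroup V] [NormedSpace ℝ V] [FiniteDimensional ℝ V]

theorem summable_one_add_norm_rpow_neg (L : AddSubgroup V) [DiscreteTopology L] {r : ℝ}
    (hr : Module.finrank ℝ V < r) : Summable fun y : L => (1 + ‖(y : V)‖) ^ (-r) := by
  have hdisc : DiscreteTopology L.toIntSubmodule := inferInstanceAs (DiscreteTopology L)
  have hrank : Module.finrank ℤ L.toIntSubmodule ≤ Module.finrank ℝ V := by
    have h := Real.finrank_eq_int_finrank_of_discrete (s := (L.toIntSubmodule : Set V))
      (by rwa [Submodule.span_eq])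
    rw [Set.finrank, Set.finrank, Submodule.span_eq] at h
    exact h ▸ Submodule.finrank_le _
  have hr0 : 0 < r := (Nat.cast_nonneg _).trans_lt hr
  have hsum : Summable fun y : L => ‖(y : V)‖ ^ (-r) :=
    ZLattice.summable_norm_rpow L.toIntSubmodule (-r)
      (neg_lt_neg ((Nat.cast_le.mpr hrank).trans_lt hr))
  refine .of_norm_bounded_eventually hsum ?_
  filter_upwards [(Set.finite_singleton (0 : L)).compl_mem_cofinite] with y hy
  have hy : 0 < ‖(y : V)‖ := norm_pos_iff.mpr fun h => hy (Subtype.ext h)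
  rw [Real.norm_of_nonneg (by positivity)]
  exact Real.rpow_le_rpow_of_nonpos hy (by linarith) (neg_nonpos.mpr hr0.le)

namespace HasPolynomialDecay

variable {u : V → ℝ} (hu : HasPolynomialDecay u)

include hu

theorem integrable [MeasurableSpace V] [BorelSpace V] (μ : Measure V) [μ.IsAddHaarMeasure] :
    Integrable u μ := by
  obtain ⟨C, r, hr, hC⟩ := hu.exists_norm_le
  exact ((integrable_one_add_norm hr).const_mul C).mono' hu.continuous.aestronglyMeasurable
    (.of_forall hC)

theorem exists_summable_bound (L : AddSubgroup V) [DiscreteTopology L] (R : ℝ) :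
    ∃ a : L → ℝ, Summable a ∧ ∀ x ∈ Metric.ball (0 : V) R, ∀ y : L, ‖u (x + y)‖ ≤ a y := by
  obtain ⟨C, r, hr, hC⟩ := hu.exists_norm_le
  have hr0 : 0 < r := (Nat.cast_nonneg _).trans_lt hr
  have hC0 : 0 ≤ C := by simpa using (norm_nonneg _).trans (hC 0)
  refine ⟨fun y => C * ((1 + R) ^ r * (1 + ‖(y : V)‖) ^ (-r)),
    ((summable_one_add_norm_rpow_neg L hr).mul_left _).mul_left _, fun x hx y =>
    (hC _).trans (mul_le_mul_of_nonneg_left ?_ hC0)⟩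
  rw [mem_ball_zero_iff] at hx
  have hxy : ‖(y : V)‖ ≤ ‖x‖ + ‖x + y‖ := by
    simpa [add_comm] using norm_sub_le (x + y) x
  have hR : 1 + ‖(y : V)‖ ≤ (1 + R) * (1 + ‖x + y‖) := by
    nlinarith [norm_nonneg x, norm_nonneg (x + y)]
  have hR0 : 0 < 1 + R := by linarith [norm_nonneg x]
  calc (1 + ‖x + y‖) ^ (-r) = (1 + R) ^ r * ((1 + R) * (1 + ‖x + y‖)) ^ (-r) := by
        rw [Real.mul_rpow hR0.le (by positivity), ← mul_assoc, ← Real.rpow_add hR0, add_neg_cancel,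
          Real.rpow_zero, one_mul]
    _ ≤ (1 + R) ^ r * (1 + ‖(y : V)‖) ^ (-r) := by
        gcongr ?_ * ?_
        exact Real.rpow_le_rpow_of_nonpos (by positivity) hR (neg_nonpos.mpr hr0.le)

variable (L : AddSubgroup V) [DiscreteTopology L]

theorem summable_add (x : V) : Summable fun y : L => u (x + y) := by
  obtain ⟨a, ha, hle⟩ := hu.exists_summable_bound L (‖x‖ + 1)
  exact .of_norm_bounded ha (hle x (by simp))

theorem summable : Summable fun y : L => u y := by
  simpa only [zero_add] using hu.summable_add L 0

theorem continuous_tsum_add : Continuous fun x => ∑' y : L, u (x + y) := by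
  refine continuous_iff_continuousAt.mpr fun x => ?_
  obtain ⟨a, ha, hle⟩ := hu.exists_summable_bound L (‖x‖ + 1)
  have hcont := hu.continuous
  refine (continuousOn_tsum (fun y => by fun_prop) ha fun y x hx => hle x hx y).continuousAt ?_
  exact Metric.isOpen_ball.mem_nhds (by simp)

end HasPolynomialDecay

end Lattice

section DiscreteHaar

variable {G : Type*} [AddGroup G] [TopologicalSpace G] [IsTopologicalAddGroup G]
  [DiscreteTopology G] [Countable G] [MeasurableSpace G] [BorelSpace G] (μ : Measure G)
  [μ.IsAddHaarMeasure]

theorem addHaar_eq_smul_count : μ = μ {0} • Measure.count := by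
  refine Measure.ext_of_singleton fun x => ?_
  rw [Measure.addHaar_singleton, Measure.smul_apply, Measure.count_singleton, smul_eq_mul, mul_one]

theorem integrable_addHaar_of_summable {f : G → ℝ} (hf : Summable f) : Integrable f μ := by
  rw [addHaar_eq_smul_count μ]
  exact (integrable_count_iff.mpr hf.norm).smul_measure isCompact_singleton.measure_lt_top.ne

theorem integral_addHaar_eq_tsum {f : G → ℝ} (hf : Summable f) :
    ∫ x, f x ∂μ = μ.real {0} * ∑' x, f x := by
  rw [integral_countable (integrable_addHaar_of_summable μ hf), ← tsum_mul_left]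
  simp only [measureReal_def, Measure.addHaar_singleton, smul_eq_mul]

end DiscreteHaar

namespace HasPolynomialDecay

variable {V : Type*} [NormedAddCommGroup V] [NormedSpace ℝ V] [FiniteDimensional ℝ V]
  [MeasurableSpace V] [BorelSpace V] {u : V → ℝ} (hu : HasPolynomialDecay u)
  {L : AddSubgroup V} [DiscreteTopology L]

include hu

theorem quotientFun_mk (x : V) :
    quotientFun L u x = (∑' y : L, u (x + y)) / ∑' y : L, u y := by
  have : Countable L := countable_of_Lindelof_of_discrete
  have h0 : (Measure.addHaar : Measure L).real {0} ≠ 0 := by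
    rw [measureReal_ne_zero_iff isCompact_singleton.measure_lt_top.ne]
    exact (isOpen_discrete _).measure_ne_zero _ (Set.singleton_nonempty _)
  calc quotientFun L u x = (∫ y : L, u (x + y) ∂Measure.addHaar) / ∫ y : L, u y ∂Measure.addHaar :=
        rfl
    _ = _ := by
        rw [integral_addHaar_eq_tsum _ (hu.summable_add L x),
          integral_addHaar_eq_tsum _ (hu.summable L), mul_div_mul_left _ _ h0]

theorem continuous_quotientFun : Continuous (quotientFun L u) := by
  refine (QuotientAddGroup.isQuotientMap_mk L).continuous_iff.mpr ?_
  simp only [Function.comp_def, hu.quotientFun_mk]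
  exact (hu.continuous_tsum_add L).div_const _

variable (hpos : ∀ x, 0 < u x)

include hpos

theorem quotientFun_pos (q : V ⧸ L) : 0 < quotientFun L u q := by
  obtain ⟨x, rfl⟩ := QuotientAddGroup.mk_surjective q
  rw [hu.quotientFun_mk]
  exact div_pos ((hu.summable_add L x).tsum_pos (fun y => (hpos _).le) 0 (hpos _))
    ((hu.summable L).tsum_pos (fun y => (hpos _).le) 0 (hpos _))

theorem average_quotientFun_nonneg : 0 ≤ ⨍ q, quotientFun L u q ∂Measure.addHaar := by
  rw [average_eq]
  exact smul_nonneg (inv_nonneg.mpr measureReal_nonneg)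
    (integral_nonneg fun q => (hu.quotientFun_pos hpos q).le)

theorem quotientFun_zero : quotientFun L u 0 = 1 := by
  rw [← QuotientAddGroup.mk_zero, hu.quotientFun_mk]
  simp only [zero_add]
  exact div_self ((hu.summable L).tsum_pos (fun y => (hpos _).le) 0 (hpos _)).ne'

end HasPolynomialDecay

/-! ### Unfolding -/

theorem automorphize_mk {G M : Type*} [AddCommGroup G] [AddCommMonoid M] [TopologicalSpace M]
    [T2Space M] {L : AddSubgroup G} (f : G → M) (x : G) :
    QuotientAddGroup.automorphize f (x : G ⧸ L) = ∑' y : L, f (x + y) :=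
  (L.equivOp.tsum_eq fun a : L.op => f (a +ᵥ x)).symm

section Unfolding

variable {V ι : Type*} [NormedAddCommGroup V] [NormedSpace ℝ V] [Finite ι] (b : Module.Basis ι ℝ V)
  {L : AddSubgroup V} (hL : L = (Submodule.span ℤ (Set.range b)).toAddSubgroup)

include hL

theorem compactSpace_quotient_of_basis : CompactSpace (V ⧸ L) := by
  have := b.finiteDimensional_of_finite
  have := FiniteDimensional.proper ℝ V
  cases nonempty_fintype ι
  have hK : IsCompact (closure (ZSpan.fundamentalDomain b)) :=
    (ZSpan.fundamentalDomain_isBounded b).isCompact_closure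
  refine ⟨(hK.image (QuotientAddGroup.continuous_mk (N := L))).of_isClosed_subset
    isClosed_univ ?_⟩
  rintro q -
  obtain ⟨x, rfl⟩ := QuotientAddGroup.mk_surjective q
  refine ⟨ZSpan.fract b x, subset_closure (ZSpan.fract_mem_fundamentalDomain _ x), ?_⟩
  rw [QuotientAddGroup.eq, ZSpan.fract_apply, neg_sub, sub_add_cancel, hL]
  exact SetLike.coe_mem _

variable [MeasurableSpace V] [BorelSpace V] (μ : Measure V)

theorem isAddFundamentalDomain_op :
    IsAddFundamentalDomain L.op (ZSpan.fundamentalDomain b) μ := by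
  subst hL
  refine .mk' (ZSpan.fundamentalDomain_measurableSet b).nullMeasurableSet fun x => ?_
  refine ((AddSubgroup.equivOp _).existsUnique_congr fun v => ?_).mp
    (ZSpan.exist_unique_vadd_mem_fundamentalDomain b x)
  exact iff_of_eq (congrArg (· ∈ _) (add_comm (v : V) x))

theorem exists_addHaar_eq_smul_map_restrict [FiniteDimensional ℝ V] [DiscreteTopology L]
    [μ.IsAddHaarMeasure] : ∃ c : NNReal, 0 < c ∧ (Measure.addHaar : Measure (V ⧸ L)) =
      c • (μ.restrict (ZSpan.fundamentalDomain b)).map QuotientAddGroup.mk := by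
  have := FiniteDimensional.proper ℝ V
  have := compactSpace_quotient_of_basis b hL
  have : Countable L := countable_of_Lindelof_of_discrete
  have hdom := isAddFundamentalDomain_op b hL μ
  have hfin : μ (ZSpan.fundamentalDomain b) < ⊤ :=
    (ZSpan.fundamentalDomain_isBounded b).measure_lt_top
  have : Fact (μ (ZSpan.fundamentalDomain b) < ⊤) := ⟨hfin⟩
  set ν : Measure (V ⧸ L) := (μ.restrict (ZSpan.fundamentalDomain b)).map QuotientAddGroup.mk
  have : IsFiniteMeasure ν := Measure.isFiniteMeasure_map _ _
  have : HasAddFundamentalDomain L.op V μ := ⟨_, hdom⟩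
  have : AddQuotientMeasureEqMeasurePreimage μ ν := hdom.addQuotientMeasureEqMeasurePreimage rfl
  have : ν.IsAddHaarMeasure := AddQuotientMeasureEqMeasurePreimage.addHaarMeasure_quotient μ
  exact ⟨_, Measure.addHaarScalarFactor_pos_of_isAddHaarMeasure _ _,
    Measure.isAddLeftInvariant_eq_smul _ ν⟩

namespace HasPolynomialDecay

variable [FiniteDimensional ℝ V] {u : V → ℝ} (hu : HasPolynomialDecay u) (hpos : ∀ x, 0 < u x)
  [DiscreteTopology L]

include hu hpos

theorem exists_integral_mul_quotientFun [μ.IsAddHaarMeasure] :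
    ∃ c : ℝ, 0 < c ∧ ∀ g : V ⧸ L → ℂ, Continuous g →
      ∫ q, g q * quotientFun L u q ∂Measure.addHaar = c * ∫ x, g (x : V ⧸ L) * u x ∂μ := by
  have := compactSpace_quotient_of_basis b hL
  have : Countable L := countable_of_Lindelof_of_discrete
  obtain ⟨c, hc, hmap⟩ := exists_addHaar_eq_smul_map_restrict b hL μ
  have hT : 0 < ∑' y : L, u y := (hu.summable L).tsum_pos (fun y => (hpos _).le) 0 (hpos _)
  have hauto (q : V ⧸ L) : QuotientAddGroup.automorphize (fun x => (u x : ℂ)) q =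
      (∑' y : L, u y : ℝ) * (quotientFun L u q : ℂ) := by
    obtain ⟨x, rfl⟩ := QuotientAddGroup.mk_surjective q
    rw [automorphize_mk, ← Complex.ofReal_tsum, hu.quotientFun_mk, ← Complex.ofReal_mul,
      mul_div_cancel₀ _ hT.ne']
  have hcont : Continuous (QuotientAddGroup.automorphize (fun x => (u x : ℂ)) : V ⧸ L → ℂ) := by
    have := hu.continuous_quotientFun (L := L)
    rw [funext hauto]
    fun_prop
  refine ⟨c / ∑' y : L, u y, by positivity, fun g hg => ?_⟩
  obtain ⟨C, hC⟩ := isCompact_univ.exists_bound_of_continuousOn hg.continuousOn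
  have hbound : essSup (fun q => ‖g q‖ₑ)
      ((μ.restrict (ZSpan.fundamentalDomain b)).map QuotientAddGroup.mk) ≠ ⊤ := by
    refine ((essSup_le_of_ae_le (ENNReal.ofReal C) (.of_forall fun x => ?_)).trans_lt
      ENNReal.ofReal_lt_top).ne
    rw [← ofReal_norm]
    exact ENNReal.ofReal_le_ofReal (hC x trivial)
  have hunfold : ∫ x, g (x : V ⧸ L) * u x ∂μ =
      ∫ q, g q * QuotientAddGroup.automorphize (fun x => (u x : ℂ)) q
        ∂(μ.restrict (ZSpan.fundamentalDomain b)).map QuotientAddGroup.mk :=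
    QuotientAddGroup.integral_mul_eq_integral_automorphize_mul (isAddFundamentalDomain_op b hL μ)
      (hu.integrable μ).ofReal hg.aestronglyMeasurable hbound hcont.aestronglyMeasurable
  rw [hunfold, hmap, integral_smul_nnreal_measure, NNReal.smul_def, Complex.real_smul]
  simp only [hauto, mul_left_comm (g _), integral_const_mul]
  rw [← mul_assoc, ← Complex.ofReal_mul, div_mul_cancel₀ _ hT.ne']

theorem integral_quotientMeasure_quotientFun [μ.IsAddHaarMeasure] {g : V ⧸ L → ℂ}
    (hg : Continuous g) : ∫ q, g q ∂(quotientMeasure (quotientFun L u)) =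
      (∫ x, g (x : V ⧸ L) * u x ∂μ) / (∫ x, u x ∂μ : ℝ) := by
  have := compactSpace_quotient_of_basis b hL
  obtain ⟨c, hc, h⟩ := hu.exists_integral_mul_quotientFun b hL μ hpos
  have h1 := h 1 continuous_one
  simp only [Pi.one_apply, one_mul, integral_complex_ofReal] at h1
  rw [integral_quotientMeasure hu.continuous_quotientFun (hu.quotientFun_pos hpos), h g hg, h1,
    mul_div_mul_left _ _ (Complex.ofReal_ne_zero.mpr hc.ne')]

end HasPolynomialDecay

end Unfolding

/-! ### Poisson summation -/

namespace HasPolynomialDecay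

open AddDual

variable {V ι Γ : Type*} [NormedAddCommGroup V] [NormedSpace ℝ V] [FiniteDimensional ℝ V]
  [MeasurableSpace V] [BorelSpace V] [Finite ι] (b : Module.Basis ι ℝ V) {L : AddSubgroup V}
  [DiscreteTopology L] (hL : L = (Submodule.span ℤ (Set.range b)).toAddSubgroup)
  [AddCommGroup Γ] [TopologicalSpace Γ] (e : (V ⧸ L) ≃ₜ+ AddDual Γ) {μ : Measure V}
  [μ.IsAddHaarMeasure] {u : V → ℝ} (hu : HasPolynomialDecay u) (hpos : ∀ x, 0 < u x) {w : Γ → ℝ}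
  (hw : ∀ y, ∫ x, (e (x : V ⧸ L)).eval y * u x ∂μ = w y * (∫ x, u x ∂μ : ℝ))

include hL hu hpos hw

theorem integral_eval_quotientMeasure (y : Γ) :
    ∫ q, (e q).eval y ∂(quotientMeasure (quotientFun L u)) = w y := by
  have h0 : 0 < ∫ x, u x ∂μ :=
    integral_pos_of_integrable_nonneg_nonzero hu.continuous (hu.integrable μ)
      (fun x => (hpos x).le) (hpos 0).ne'
  have hχ : Continuous fun q => (e q).eval y := (AddDual.continuous_eval_const y).comp e.continuous
  rw [hu.integral_quotientMeasure_quotientFun b hL μ hpos hχ, hw,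
    mul_div_cancel_right₀ _ (Complex.ofReal_ne_zero.mpr h0.ne')]

variable (hsep : ∀ y ≠ 0, ∃ a, (e a).eval y ≠ 1) (hsum : Summable w)

include hsep hsum

theorem hasSum_quotientFun :
    HasSum (fun y => (((⨍ q, quotientFun L u q ∂Measure.addHaar) * w (-y) : ℝ) : ℂ) •
        evalMap (f := e) e.continuous y)
      (⟨fun q => quotientFun L u q, Complex.continuous_ofReal.comp hu.continuous_quotientFun⟩ :
        C(V ⧸ L, ℂ)) := by
  have := compactSpace_quotient_of_basis b hL
  refine hasSum_fourier e Measure.addHaar hsep ?_ fun y => ?_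
  · exact Complex.ofRealCLM.summable
      (((Equiv.neg Γ).summable_iff.mpr hsum).mul_left _)
  · have hv := hu.continuous_quotientFun (L := L)
    have h := integral_quotientMeasure hv (hu.quotientFun_pos hpos) fun q => (e q).eval (-y)
    rw [hu.integral_eval_quotientMeasure b hL e hpos hw, eq_div_iff (Complex.ofReal_ne_zero.mpr
      (integral_addHaar_pos hv (hu.quotientFun_pos hpos)).ne')] at h
    simp only [average_eq, ContinuousMap.coe_mk, ← h, Complex.real_smul, smul_eq_mul]
    push_cast
    ring

variable (hw0 : ∀ y, 0 ≤ w y)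

include hw0

theorem isFirstKind_quotientFun : IsFirstKind (quotientFun L u) :=
  isFirstKind_of_hasSum e (hu.quotientFun_pos hpos) (hu.quotientFun_zero hpos)
    hu.continuous_quotientFun
    (fun y => mul_nonneg (hu.average_quotientFun_nonneg hpos) (hw0 (-y))) fun q =>
    ContinuousMap.hasSum_apply (hu.hasSum_quotientFun b hL e hpos hw hsep hsum) q

theorem isSecondKind_quotientMeasure_quotientFun :
    IsSecondKind (quotientMeasure (quotientFun L u)) := by
  have := compactSpace_quotient_of_basis b hL
  exact isSecondKind_quotientMeasure e (hu.isFirstKind_quotientFun b hL e hpos hw hsep hsum hw0)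
    (fun y => mul_nonneg (hu.average_quotientFun_nonneg hpos) (hw0 (-y))) (fun q => rfl)
    (hu.hasSum_quotientFun b hL e hpos hw hsep hsum)

end HasPolynomialDecay

/-! ### Dual lattices -/

namespace GhostSpace

section Pairing

variable {V : Type*} [NormedAddCommGroup V] [NormedSpace ℝ V] [FiniteDimensional ℝ V]
  (B : LinearMap.BilinForm ℝ V)

/-- The homomorphism `x ↦ exp (2 π i B x ·)` from `V` to the Pontryagin dual of the subgroup `M`. -/
def pairingHom (M : AddSubgroup V) : V →+ AddDual M where
  toFun x := AddDual.mk (fun y => Circle.exp (2 * Real.pi * B x y))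
    (by
      have := LinearMap.continuous_of_finiteDimensional (B x)
      fun_prop)
    (by simp only [ZeroMemClass.coe_zero, map_zero, mul_zero, Circle.exp_zero])
    fun y z => by rw [AddSubgroup.coe_add, map_add, mul_add, Circle.exp_add]
  map_zero' := AddDual.ext_eval fun y => by
    rw [AddDual.mk_eval, map_zero, LinearMap.zero_apply, mul_zero, Circle.exp_zero,
      AddDual.zero_eval, Circle.coe_one]
  map_add' x z := AddDual.ext_eval fun y => by
    rw [AddDual.add_eval, AddDual.mk_eval, map_add, LinearMap.add_apply, mul_add, Circle.exp_add,
      Circle.coe_mul]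
    rfl

variable {B} {M : AddSubgroup V}

theorem pairingHom_eval (x : V) (y : M) :
    (pairingHom B M x).eval y = Circle.exp (2 * Real.pi * B x y) := rfl

theorem pairingHom_eval_eq_one_iff (x : V) (y : M) :
    (pairingHom B M x).eval y = 1 ↔ ∃ n : ℤ, B x y = n := by
  rw [pairingHom_eval, Circle.coe_eq_one, Circle.exp_eq_one]
  refine exists_congr fun n => ?_
  rw [mul_comm, mul_left_inj' Real.two_pi_pos.ne']

theorem continuous_pairingHom : Continuous (pairingHom B M) := by
  have h : Continuous fun p : V × M => B.toContinuousBilinearMap p.1 p.2 := by fun_prop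
  exact AddDual.continuous_of_eval <|
    continuous_subtype_val.comp (Circle.exp.continuous.comp (continuous_const.mul h))

theorem ker_pairingHom :
    (pairingHom B M).ker = (B.dualSubmodule M.toIntSubmodule).toAddSubgroup := by
  ext x
  have hmem : x ∈ (pairingHom B M).ker ↔ ∀ y : M, (pairingHom B M x).eval y = 1 :=
    ⟨fun h y => by rw [AddMonoidHom.mem_ker.mp h, AddDual.zero_eval],
      fun h => AddDual.ext_eval fun y => (h y).trans (AddDual.zero_eval y).symm⟩
  simp only [hmem, pairingHom_eval_eq_one_iff, Submodule.mem_toAddSubgroup,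
    LinearMap.BilinForm.mem_dualSubmodule, Submodule.mem_one, Subtype.forall, algebraMap_int_eq,
    eq_intCast, eq_comm (b := B _ _)]
  rfl

variable (hB : B.Nondegenerate)

include hB

theorem pairingHom_surjective {ι : Type*} [Finite ι] (b : Module.Basis ι ℝ V)
    (hM : M = (Submodule.span ℤ (Set.range b)).toAddSubgroup) :
    Function.Surjective (pairingHom B M) := by
  classical
  cases nonempty_fintype ι
  rw [Submodule.span_int_eq_addSubgroupClosure] at hM
  subst hM
  intro χ
  choose θ hθ using fun i => Circle.exp_surjective
    (χ.toMul (.ofAdd ⟨b i, AddSubgroup.subset_closure (Set.mem_range_self i)⟩))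
  let x := ∑ i, (θ i / (2 * Real.pi)) • B.dualBasis hB b i
  have hx (i) : 2 * Real.pi * B x (b i) = θ i := by
    rw [← LinearMap.BilinForm.dualBasis_repr_apply hB, Module.Basis.repr_sum_self]
    field_simp
  refine ⟨x, AddDual.ext_eval fun ⟨y, hy⟩ => ?_⟩
  induction hy using AddSubgroup.closure_induction with
  | mem y h =>
    obtain ⟨i, rfl⟩ := h
    rw [pairingHom_eval, hx, hθ]
    rfl
  | zero => exact (AddDual.eval_zero _).trans (AddDual.eval_zero _).symm
  | add y z hy hz ihy ihz =>
    rw [← AddMemClass.mk_add_mk _ y z hy hz, AddDual.eval_add, AddDual.eval_add, ihy, ihz]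
  | neg y hy ihy =>
    have h (ψ : AddDual (AddSubgroup.closure (Set.range b))) := AddDual.eval_neg ψ ⟨y, hy⟩
    exact (h _).trans ((congrArg _ ihy).trans (h χ).symm)

theorem exists_pairingHom_eval_ne_one {y : M} (hy : y ≠ 0) :
    ∃ x, (pairingHom B M x).eval y ≠ 1 := by
  obtain ⟨x, hx⟩ : ∃ x, B x y ≠ 0 := by
    by_contra! h
    exact hy (Subtype.ext (hB.2 y h))
  refine ⟨(2 * B x y)⁻¹ • x, fun h => ?_⟩
  obtain ⟨n, hn⟩ := (pairingHom_eval_eq_one_iff _ _).mp h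
  rw [map_smul, LinearMap.smul_apply, smul_eq_mul] at hn
  have h2 : (1 : ℝ) = (2 * n : ℤ) := by
    push_cast
    rw [← hn]
    field_simp
  have := Int.cast_injective (α := ℝ) (Int.cast_one.trans h2)
  omega

/-- The isomorphism of `V / L` with the Pontryagin dual of the lattice `M`, where `L` is the dual
lattice of `M` for the bilinear form `B`. -/
def pairingEquiv {ι : Type*} [Finite ι] (b : Module.Basis ι ℝ V)
    (hM : M = (Submodule.span ℤ (Set.range b)).toAddSubgroup) {L : AddSubgroup V}
    [CompactSpace (V ⧸ L)] (hL : L = (B.dualSubmodule M.toIntSubmodule).toAddSubgroup) :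
    (V ⧸ L) ≃ₜ+ AddDual M :=
  let e : (V ⧸ L) ≃+ AddDual M :=
    (QuotientAddGroup.quotientAddEquivOfEq (hL.trans ker_pairingHom.symm)).trans
      (QuotientAddGroup.quotientKerEquivOfSurjective _ (pairingHom_surjective hB b hM))
  have he : Continuous e :=
    (QuotientAddGroup.isQuotientMap_mk L).continuous_iff.mpr continuous_pairingHom
  { e with
    continuous_toFun := he
    continuous_invFun := (he.homeoOfEquivCompactToT2 (f := e.toEquiv)).symm.continuous }

theorem pairingEquiv_mk_eval {ι : Type*} [Finite ι] (b : Module.Basis ι ℝ V)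
    (hM : M = (Submodule.span ℤ (Set.range b)).toAddSubgroup) {L : AddSubgroup V}
    [CompactSpace (V ⧸ L)] (hL : L = (B.dualSubmodule M.toIntSubmodule).toAddSubgroup) (x : V)
    (y : M) : (pairingEquiv hB b hM hL (x : V ⧸ L)).eval y = Circle.exp (2 * Real.pi * B x y) :=
  rfl

end Pairing

end GhostSpace

/-! ### Gaussian functions -/

namespace GhostSpace

section Decay

variable {V : Type*} [NormedAddCommGroup V] [NormedSpace ℝ V] [FiniteDimensional ℝ V] {q : V → ℝ}

theorem exists_mul_sq_norm_le (hq : Continuous q) (hsmul : ∀ (t : ℝ) x, q (t • x) = t ^ 2 * q x)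
    (hpos : ∀ x ≠ 0, 0 < q x) : ∃ c > 0, ∀ x, c * ‖x‖ ^ 2 ≤ q x := by
  have := FiniteDimensional.proper_real V
  obtain ⟨c, hc, h⟩ := (isCompact_sphere (0 : V) 1).exists_forall_le' hq.continuousOn fun x hx =>
    hpos x (ne_zero_of_mem_unit_sphere ⟨x, hx⟩)
  refine ⟨c, hc, fun x => ?_⟩
  rcases eq_or_ne x 0 with rfl | hx
  · simpa using (hsmul 0 0).ge
  · have hx' : ‖x‖ ≠ 0 := norm_ne_zero_iff.mpr hx
    have hunit : ‖x‖⁻¹ • x ∈ Metric.sphere (0 : V) 1 := by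
      rw [mem_sphere_zero_iff_norm, norm_smul, norm_inv, norm_norm, inv_mul_cancel₀ hx']
    calc c * ‖x‖ ^ 2 ≤ q (‖x‖⁻¹ • x) * ‖x‖ ^ 2 := by gcongr; exact h _ hunit
      _ = q x := by rw [hsmul]; field_simp

theorem hasPolynomialDecay_exp_neg (hq : Continuous q)
    (hsmul : ∀ (t : ℝ) x, q (t • x) = t ^ 2 * q x) (hpos : ∀ x ≠ 0, 0 < q x) :
    HasPolynomialDecay fun x => Real.exp (-q x) where
  continuous := by fun_prop
  exists_norm_le := by
    obtain ⟨c, hc, h⟩ := exists_mul_sq_norm_le hq hsmul hpos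
    let n := Module.finrank ℝ V + 1
    refine ⟨Real.exp c * (n.factorial * (2 / c) ^ n), (2 * n : ℕ), ?_, fun x => ?_⟩
    · norm_cast
      omega
    have hexp : (c / 2 * (1 + ‖x‖) ^ 2) ^ n / n.factorial ≤ Real.exp (c / 2 * (1 + ‖x‖) ^ 2) :=
      Real.pow_div_factorial_le_exp _ (by positivity) n
    have hle : -q x ≤ c - c / 2 * (1 + ‖x‖) ^ 2 := by
      nlinarith [h x, mul_nonneg hc.le (sq_nonneg (‖x‖ - 1))]
    calc ‖Real.exp (-q x)‖ ≤ Real.exp c / Real.exp (c / 2 * (1 + ‖x‖) ^ 2) := by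
          rw [Real.norm_of_nonneg (Real.exp_pos _).le, ← Real.exp_sub]
          gcongr
      _ ≤ Real.exp c / ((c / 2 * (1 + ‖x‖) ^ 2) ^ n / n.factorial) := by gcongr
      _ = _ := by
          rw [Real.rpow_neg (by positivity), Real.rpow_natCast, mul_pow, div_pow, div_pow,
            ← pow_mul]
          field_simp

end Decay

theorem integral_cexp_inner_mul_gaussian {V : Type*} [NormedAddCommGroup V]
    [InnerProductSpace ℝ V] [FiniteDimensional ℝ V] [MeasurableSpace V] [BorelSpace V] {a : ℝ}
    (ha : 0 < a) (w : V) :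
    ∫ v : V, Complex.exp (2 * Real.pi * Complex.I * (inner ℝ w v : ℝ)) *
        (Real.exp (-(Real.pi * (‖v‖ ^ 2 * a))) : ℂ) =
      (Real.exp (-(Real.pi * (‖w‖ ^ 2 * a⁻¹))) : ℂ) *
        ∫ v : V, (Real.exp (-(Real.pi * (‖v‖ ^ 2 * a))) : ℂ) := by
  have hb : 0 < ((Real.pi * a : ℝ) : ℂ).re := mul_pos Real.pi_pos ha
  have hgauss (v : V) : (Real.exp (-(Real.pi * (‖v‖ ^ 2 * a))) : ℂ) =
      Complex.exp (-((Real.pi * a : ℝ) : ℂ) * ‖v‖ ^ 2) := by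
    rw [Complex.ofReal_exp]
    push_cast
    ring_nf
  have hint (v : V) : Complex.exp (2 * Real.pi * Complex.I * (inner ℝ w v : ℝ)) *
      (Real.exp (-(Real.pi * (‖v‖ ^ 2 * a))) : ℂ) =
      Complex.exp (-((Real.pi * a : ℝ) : ℂ) * ‖v‖ ^ 2 + 2 * Real.pi * Complex.I * inner ℝ w v) := by
    rw [hgauss, ← Complex.exp_add, add_comm]
  have hexponent : (2 * Real.pi * Complex.I) ^ 2 * (‖w‖ : ℂ) ^ 2 / (4 * ((Real.pi * a : ℝ) : ℂ)) =
      (-(Real.pi * (‖w‖ ^ 2 * a⁻¹)) : ℝ) := by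
    have := Complex.ofReal_ne_zero.mpr ha.ne'
    have := Complex.ofReal_ne_zero.mpr Real.pi_ne_zero
    push_cast
    field_simp
    rw [Complex.I_sq]
    ring
  simp_rw [hint, hgauss]
  rw [GaussianFourier.integral_cexp_neg_mul_sq_norm_add hb,
    GaussianFourier.integral_cexp_neg_mul_sq_norm hb, hexponent, Complex.ofReal_exp, mul_comm]

section Product

variable {ι κ : Type*} [Fintype ι] [Fintype κ] {a : ι → ℝ} {b : κ → ℝ}

theorem integral_prod_mul_prod (f : ι → ℝ → ℂ) (g : κ → ℂ → ℂ) :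
    ∫ x : (ι → ℝ) × (κ → ℂ), (∏ i, f i (x.1 i)) * ∏ j, g j (x.2 j) =
      (∏ i, ∫ t, f i t) * ∏ j, ∫ z, g j z := by
  rw [Measure.volume_eq_prod, integral_prod_mul (fun x : ι → ℝ => ∏ i, f i (x i))
    (fun x : κ → ℂ => ∏ j, g j (x j)), integral_fintype_prod_volume_eq_prod,
    integral_fintype_prod_volume_eq_prod]

/-- The diagonal Gaussian function on `ℝ ^ ι × ℂ ^ κ` with the weights `a` and `b`. -/
def diagGaussian (a : ι → ℝ) (b : κ → ℝ) (z : (ι → ℝ) × (κ → ℂ)) : ℝ :=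
  Real.exp (-(Real.pi * (∑ i, ‖z.1 i‖ ^ 2 * a i + ∑ j, ‖z.2 j‖ ^ 2 * b j)))

/-- The character `x ↦ exp (2 π i ⟪w, x⟫)` of `ℝ ^ ι × ℂ ^ κ`, for the real inner product. -/
def innerChar (w x : (ι → ℝ) × (κ → ℂ)) : ℂ :=
  Complex.exp (2 * Real.pi * Complex.I *
    (∑ i, inner ℝ (w.1 i) (x.1 i) + ∑ j, inner ℝ (w.2 j) (x.2 j) : ℝ))

theorem diagGaussian_eq_prod (z : (ι → ℝ) × (κ → ℂ)) : (diagGaussian a b z : ℂ) =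
    (∏ i, (Real.exp (-(Real.pi * (‖z.1 i‖ ^ 2 * a i))) : ℂ)) *
      ∏ j, (Real.exp (-(Real.pi * (‖z.2 j‖ ^ 2 * b j))) : ℂ) := by
  rw [diagGaussian, mul_add, Finset.mul_sum, Finset.mul_sum, neg_add, Real.exp_add,
    ← Finset.sum_neg_distrib, ← Finset.sum_neg_distrib, Real.exp_sum, Real.exp_sum,
    Complex.ofReal_mul, Complex.ofReal_prod, Complex.ofReal_prod]

theorem innerChar_eq_prod (w x : (ι → ℝ) × (κ → ℂ)) : innerChar w x =
    (∏ i, Complex.exp (2 * Real.pi * Complex.I * (inner ℝ (w.1 i) (x.1 i) : ℝ))) *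
      ∏ j, Complex.exp (2 * Real.pi * Complex.I * (inner ℝ (w.2 j) (x.2 j) : ℝ)) := by
  rw [innerChar, Complex.ofReal_add, Complex.ofReal_sum, Complex.ofReal_sum, mul_add,
    Finset.mul_sum, Finset.mul_sum, Complex.exp_add, Complex.exp_sum, Complex.exp_sum]

theorem innerChar_sub (w w' x : (ι → ℝ) × (κ → ℂ)) :
    innerChar (w - w') x = innerChar w x * star (innerChar w' x) := by
  simp only [innerChar, Prod.fst_sub, Prod.snd_sub, Pi.sub_apply, inner_sub_left,
    Finset.sum_sub_distrib]
  rw [Complex.star_def, ← Complex.exp_conj, ← Complex.exp_add]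
  simp only [map_mul, Complex.conj_ofReal, Complex.conj_I, map_ofNat]
  push_cast
  ring_nf

theorem norm_innerChar (w x : (ι → ℝ) × (κ → ℂ)) : ‖innerChar w x‖ = 1 := by
  rw [innerChar, Complex.norm_exp]
  simp

theorem integral_innerChar_mul_diagGaussian (ha : ∀ i, 0 < a i) (hb : ∀ j, 0 < b j)
    (w : (ι → ℝ) × (κ → ℂ)) : ∫ x, innerChar w x * diagGaussian a b x =
      diagGaussian (fun i => (a i)⁻¹) (fun j => (b j)⁻¹) w * ∫ x, (diagGaussian a b x : ℂ) := by
  simp_rw [innerChar_eq_prod, diagGaussian_eq_prod, mul_mul_mul_comm, ← Finset.prod_mul_distrib]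
  rw [integral_prod_mul_prod
      (fun i t => Complex.exp (2 * Real.pi * Complex.I * (inner ℝ (w.1 i) t : ℝ)) *
        (Real.exp (-(Real.pi * (‖t‖ ^ 2 * a i))) : ℂ))
      (fun j z => Complex.exp (2 * Real.pi * Complex.I * (inner ℝ (w.2 j) z : ℝ)) *
        (Real.exp (-(Real.pi * (‖z‖ ^ 2 * b j))) : ℂ)),
    integral_prod_mul_prod (fun i t => (Real.exp (-(Real.pi * (‖t‖ ^ 2 * a i))) : ℂ))
      (fun j z => (Real.exp (-(Real.pi * (‖z‖ ^ 2 * b j))) : ℂ)),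
    mul_mul_mul_comm, ← Finset.prod_mul_distrib, ← Finset.prod_mul_distrib]
  simp only [integral_cexp_inner_mul_gaussian (ha _), integral_cexp_inner_mul_gaussian (hb _)]

theorem hasPolynomialDecay_diagGaussian (ha : ∀ i, 0 < a i) (hb : ∀ j, 0 < b j) :
    HasPolynomialDecay (diagGaussian a b) := by
  refine hasPolynomialDecay_exp_neg (by fun_prop) (fun t z => ?_) fun z hz => ?_
  · simp only [Prod.smul_fst, Prod.smul_snd, Pi.smul_apply, norm_smul, mul_pow, Real.norm_eq_abs,
      sq_abs, mul_assoc, ← Finset.mul_sum]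
    ring
  · have hR (i) (_ : i ∈ Finset.univ) : 0 ≤ ‖z.1 i‖ ^ 2 * a i := by have := ha i; positivity
    have hC (j) (_ : j ∈ Finset.univ) : 0 ≤ ‖z.2 j‖ ^ 2 * b j := by have := hb j; positivity
    refine mul_pos Real.pi_pos <| (add_nonneg (Finset.sum_nonneg hR)
      (Finset.sum_nonneg hC)).lt_of_ne' fun h => hz ?_
    obtain ⟨h1, h2⟩ := (add_eq_zero_iff_of_nonneg (Finset.sum_nonneg hR)
      (Finset.sum_nonneg hC)).mp h
    rw [Finset.sum_eq_zero_iff_of_nonneg hR] at h1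
    rw [Finset.sum_eq_zero_iff_of_nonneg hC] at h2
    exact Prod.ext (funext fun i => by simpa [(ha i).ne'] using h1 i (Finset.mem_univ i))
      (funext fun j => by simpa [(hb j).ne'] using h2 j (Finset.mem_univ j))

theorem isPositiveDefinite_diagGaussian (ha : ∀ i, 0 < a i) (hb : ∀ j, 0 < b j) :
    IsPositiveDefinite fun z => (diagGaussian a b z : ℂ) := by
  have ha' (i) : 0 < (a i)⁻¹ := inv_pos.mpr (ha i)
  have hb' (j) : 0 < (b j)⁻¹ := inv_pos.mpr (hb j)
  let u : (ι → ℝ) × (κ → ℂ) → ℝ := diagGaussian (fun i => (a i)⁻¹) fun j => (b j)⁻¹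
  have hu : HasPolynomialDecay u := hasPolynomialDecay_diagGaussian ha' hb'
  have hpos (z) : 0 < u z := Real.exp_pos _
  have : (volume : Measure ((ι → ℝ) × (κ → ℂ))).IsAddHaarMeasure :=
    Measure.prod.instIsAddHaarMeasure volume volume
  have hu_int : 0 < ∫ x, u x := integral_pos_of_integrable_nonneg_nonzero hu.continuous
    (hu.integrable volume) (fun x => (hpos x).le) (hpos 0).ne'
  have hfourier (w) : ((∫ x, u x : ℝ) : ℂ)⁻¹ * ∫ x, innerChar w x * u x = diagGaussian a b w := by
    rw [integral_innerChar_mul_diagGaussian ha' hb', integral_complex_ofReal,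
      mul_comm, mul_assoc, mul_inv_cancel₀ (Complex.ofReal_ne_zero.mpr hu_int.ne')]
    simp only [inv_inv, mul_one]
  have hchar (x) : IsPositiveDefinite fun w => innerChar w x * u x := by
    simp only [mul_comm _ (u x : ℂ)]
    exact .const_mul (.of_map_sub (innerChar · x) fun w w' => innerChar_sub w w' x)
      (by exact_mod_cast (hpos x).le)
  simp only [← hfourier]
  refine .const_mul (.integral hchar fun w => ?_) ?_
  · refine (hu.integrable volume).ofReal.bdd_mul (c := 1) ?_ (.of_forall fun x => ?_)
    · have : Continuous (innerChar w) := by unfold innerChar; fun_prop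
      exact this.aestronglyMeasurable
    · exact (norm_innerChar w x).le
  · rw [← Complex.ofReal_inv]
    exact_mod_cast (inv_pos.mpr hu_int).le

theorem isFirstKind_diagGaussian (ha : ∀ i, 0 < a i) (hb : ∀ j, 0 < b j) :
    IsFirstKind (diagGaussian a b) where
  continuous := (hasPolynomialDecay_diagGaussian ha hb).continuous
  pos _ := Real.exp_pos _
  map_zero := by simp [diagGaussian]
  positiveDefinite := isPositiveDefinite_diagGaussian ha hb

end Product

end GhostSpace

/-! ### Lattices of divisors -/

theorem trace_map_of_basis {ι R S A B : Type*} [Finite ι] [CommRing R] [CommRing S] [CommRing A]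
    [CommRing B] [Algebra R A] [Algebra S B] {f : R →+* S} {φ : A →+* B}
    (hφ : ∀ r, φ (algebraMap R A r) = algebraMap S B (f r)) (b : Module.Basis ι R A)
    {b' : Module.Basis ι S B} (hb : ∀ i, b' i = φ (b i)) (a : A) :
    Algebra.trace S B (φ a) = f (Algebra.trace R A a) := by
  classical
  cases nonempty_fintype ι
  have hrepr (i : ι) : φ a * b' i = ∑ j, f (b.repr (a * b i) j) • b' j := by
    rw [hb, ← map_mul, ← b.sum_repr (a * b i), map_sum]
    refine Finset.sum_congr rfl fun j _ => ?_
    rw [b.sum_repr, hb, Algebra.smul_def, map_mul, hφ, Algebra.smul_def]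
  rw [Algebra.trace_eq_matrix_trace b, Algebra.trace_eq_matrix_trace b', Matrix.trace, Matrix.trace,
    map_sum]
  refine Finset.sum_congr rfl fun i _ => ?_
  rw [Matrix.diag_apply, Matrix.diag_apply, Algebra.leftMulMatrix_eq_repr_mul,
    Algebra.leftMulMatrix_eq_repr_mul, hrepr, Module.Basis.repr_sum_self]

theorem trace_pi_eq_sum {ι R : Type*} [Fintype ι] [CommRing R] (S : ι → Type*)
    [∀ i, CommRing (S i)] [∀ i, Algebra R (S i)] [∀ i, Module.Free R (S i)]
    [∀ i, Module.Finite R (S i)] (x : ∀ i, S i) :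
    Algebra.trace R (∀ i, S i) x = ∑ i, Algebra.trace R (S i) (x i) := by
  classical
  let b (i : ι) := Module.Free.chooseBasis R (S i)
  rw [Algebra.trace_eq_matrix_trace (Pi.basis b), Matrix.trace, Fintype.sum_sigma]
  refine Finset.sum_congr rfl fun i _ => ?_
  rw [Algebra.trace_eq_matrix_trace (b i), Matrix.trace]
  refine Finset.sum_congr rfl fun j _ => ?_
  simp [Algebra.leftMulMatrix_eq_repr_mul]

namespace ArakelovDivisor

open mixedEmbedding

variable {F : Type*} [Field F] [NumberField F]

theorem ideal_sub (D E : ArakelovDivisor F) : (D - E).ideal = D.ideal * E.ideal⁻¹ := by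
  unfold ideal
  rw [Prod.fst_sub, sub_eq_add_neg, Finsupp.prod_add_index' (by simp) (fun P m n => by
    rw [neg_add, zpow_add]), Finsupp.prod_neg_index (by simp), Finsupp.prod, Finsupp.prod,
    Finsupp.prod, ← Finset.prod_inv_distrib]
  simp [zpow_neg]

theorem coe_ideal (D : ArakelovDivisor F) : (D.ideal : FractionalIdeal (𝓞 F)⁰ F) =
    (∏ᶠ P : HeightOneSpectrum (𝓞 F), (P.asIdeal : FractionalIdeal (𝓞 F)⁰ F) ^ D.1 P)⁻¹ := by
  rw [finprod_eq_prod_of_mulSupport_subset (s := D.1.support)]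
  · rw [ideal, Finsupp.prod, Units.coe_prod, ← Finset.prod_inv_distrib]
    simp [primeUnit]
  · intro P hP
    contrapose! hP
    simp_all

theorem coe_ideal_canonical : ((canonical F).ideal : FractionalIdeal (𝓞 F)⁰ F) =
    (differentIdeal ℤ (𝓞 F) : FractionalIdeal (𝓞 F)⁰ F)⁻¹ := by
  rw [coe_ideal]
  exact congrArg _ (FractionalIdeal.finprod_heightOneSpectrum_factorization' F
    (FractionalIdeal.coeIdeal_ne_zero.mpr differentIdeal_ne_bot))

theorem coe_ideal_canonical_sub (D : ArakelovDivisor F) :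
    ((canonical F - D).ideal : FractionalIdeal (𝓞 F)⁰ F) =
      (differentIdeal ℤ (𝓞 F) : FractionalIdeal (𝓞 F)⁰ F)⁻¹ *
        (D.ideal : FractionalIdeal (𝓞 F)⁰ F)⁻¹ := by
  rw [ideal_sub, Units.val_mul, coe_ideal_canonical, Units.val_inv_eq_inv_val]

theorem coe_ideal_canonical_sub_eq_dual (D : ArakelovDivisor F) :
    ((canonical F - D).ideal : FractionalIdeal (𝓞 F)⁰ F) =
      FractionalIdeal.dual ℤ ℚ (D.ideal : FractionalIdeal (𝓞 F)⁰ F) := by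
  rw [coe_ideal_canonical_sub, coeIdeal_differentIdeal ℤ ℚ, inv_inv,
    ← FractionalIdeal.dual_eq_mul_inv]

/-- A basis of `F ⊗ ℝ` that spans the lattice of `D` over `ℤ`. -/
def latticeBasis (D : ArakelovDivisor F) :
    Module.Basis (Module.Free.ChooseBasisIndex ℤ D.ideal) ℝ (mixedSpace F) :=
  fractionalIdealLatticeBasis F D.ideal

theorem latticeBasis_apply (D : ArakelovDivisor F) (i) :
    D.latticeBasis i = mixedEmbedding F (basisOfFractionalIdeal F D.ideal i) :=
  fractionalIdealLatticeBasis_apply F D.ideal i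

theorem lattice_eq_span (D : ArakelovDivisor F) :
    D.lattice = (Submodule.span ℤ (Set.range D.latticeBasis)).toAddSubgroup :=
  congrArg Submodule.toAddSubgroup (span_idealLatticeBasis F D.ideal).symm

instance (D : ArakelovDivisor F) : CompactSpace (mixedSpace F ⧸ D.lattice) := by
  classical exact compactSpace_quotient_of_basis D.latticeBasis D.lattice_eq_span

theorem trace_mixedEmbedding (a : F) :
    Algebra.trace ℝ (mixedSpace F) (mixedEmbedding F a) = (Algebra.trace ℚ F a : ℝ) :=
  trace_map_of_basis (f := algebraMap ℚ ℝ)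
    (fun r => Prod.ext (funext fun w => by simp [mixedEmbedding_apply_isReal])
      (funext fun w => by simp [mixedEmbedding_apply_isComplex]))
    (basisOfFractionalIdeal F 1) (fractionalIdealLatticeBasis_apply F 1) a

open scoped Classical in
theorem trace_mixedSpace (x : mixedSpace F) : Algebra.trace ℝ (mixedSpace F) x =
    ∑ w : {w : InfinitePlace F // w.IsReal}, x.1 w +
      ∑ w : {w : InfinitePlace F // w.IsComplex}, 2 * (x.2 w).re := by
  rw [Algebra.trace_prod_apply, trace_pi_eq_sum, trace_pi_eq_sum]
  simp only [Algebra.trace_self_apply, Algebra.trace_complex_apply]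

theorem traceForm_mixedSpace_nondegenerate :
    (Algebra.traceForm ℝ (mixedSpace F)).Nondegenerate := by
  classical
  have hrefl : LinearMap.IsRefl (Algebra.traceForm ℝ (mixedSpace F)) :=
    (Algebra.traceForm_isSymm ℝ).isRefl
  refine hrefl.nondegenerate_iff_separatingLeft.mpr fun x hx => ?_
  have h := hx (star x)
  have hR (w) (_ : w ∈ Finset.univ) : 0 ≤ x.1 w * x.1 w := mul_self_nonneg _
  have hC (w) (_ : w ∈ Finset.univ) : 0 ≤ 2 * Complex.normSq (x.2 w) :=
    mul_nonneg zero_le_two (Complex.normSq_nonneg _)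
  simp only [Algebra.traceForm_apply, trace_mixedSpace, Prod.fst_mul, Prod.snd_mul, Pi.mul_apply,
    Prod.fst_star, Prod.snd_star, Pi.star_apply, star_trivial, Complex.star_def, Complex.mul_conj,
    Complex.ofReal_re] at h
  rw [add_eq_zero_iff_of_nonneg (Finset.sum_nonneg hR) (Finset.sum_nonneg hC),
    Finset.sum_eq_zero_iff_of_nonneg hR, Finset.sum_eq_zero_iff_of_nonneg hC] at h
  exact Prod.ext (funext fun w => by simpa using h.1 w (Finset.mem_univ w))
    (funext fun w => by simpa using h.2 w (Finset.mem_univ w))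

theorem lattice_canonical_sub (D : ArakelovDivisor F) : (canonical F - D).lattice =
    ((Algebra.traceForm ℝ (mixedSpace F)).dualSubmodule
      D.lattice.toIntSubmodule).toAddSubgroup := by
  classical
  let b := basisOfFractionalIdeal F D.ideal
  have hideal : (((canonical F - D).ideal : FractionalIdeal (𝓞 F)⁰ F) :
      Submodule (𝓞 F) F).restrictScalars ℤ = Submodule.span ℤ (Set.range b.traceDual) := by
    rw [coe_ideal_canonical_sub_eq_dual, FractionalIdeal.coe_dual _ _ D.ideal.ne_zero]
    refine Submodule.traceDual_span_of_basis ℤ _ b (Submodule.ext fun x => ?_)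
    exact (mem_span_basisOfFractionalIdeal F).symm
  have hbasis : (Algebra.traceForm ℝ (mixedSpace F)).dualBasis
      traceForm_mixedSpace_nondegenerate D.latticeBasis = mixedEmbedding F ∘ b.traceDual := by
    refine (LinearMap.BilinForm.dualBasis_eq_iff _ _ _).mpr fun i j => ?_
    rw [Algebra.traceForm_apply, latticeBasis_apply, Function.comp_apply, ← map_mul,
      trace_mixedEmbedding, b.trace_traceDual_mul]
    split_ifs <;> simp
  have hlattice : D.lattice.toIntSubmodule = Submodule.span ℤ (Set.range D.latticeBasis) :=
    (span_idealLatticeBasis F D.ideal).symm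
  rw [hlattice, LinearMap.BilinForm.dualSubmodule_span_of_basis _
    traceForm_mixedSpace_nondegenerate, hbasis, Set.range_comp]
  have hmap := Submodule.map_span (mixedEmbedding F).toIntAlgHom.toLinearMap
    (Set.range b.traceDual)
  refine congrArg Submodule.toAddSubgroup (Eq.trans ?_ hmap)
  ext x
  rw [mem_idealLattice, ← hideal]
  rfl

/-! ### Serre duality -/

variable (D : ArakelovDivisor F)

open scoped Classical in
theorem gaussian_eq_diagGaussian : D.gaussian =
    diagGaussian (fun w : {w : InfinitePlace F // w.IsReal} => Real.exp (-2 * D.2 w))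
      (fun w : {w : InfinitePlace F // w.IsComplex} => 2 * Real.exp (-D.2 w)) := by
  ext z
  rw [gaussian, neg_mul]
  rfl

open scoped Classical in
theorem hasPolynomialDecay_gaussian : HasPolynomialDecay D.gaussian := by
  rw [gaussian_eq_diagGaussian]
  exact hasPolynomialDecay_diagGaussian (fun _ => Real.exp_pos _) fun _ => by positivity

theorem isFirstKind_gaussian : IsFirstKind D.gaussian := by
  classical
  rw [gaussian_eq_diagGaussian]
  exact isFirstKind_diagGaussian (fun _ => Real.exp_pos _) fun _ => by positivity

theorem isFirstKind_effectivity : IsFirstKind D.effectivity :=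
  D.isFirstKind_gaussian.restrict D.lattice

open scoped Classical in
theorem tracePairing_eq_innerChar (x y : mixedSpace F) :
    tracePairing x y = innerChar (y.1, fun w => 2 * star (y.2 w)) x := by
  rw [tracePairing, innerChar, trace_mixedSpace]
  congr 4
  refine Finset.sum_congr rfl fun w _ => ?_
  simp only [Prod.snd_mul, Pi.mul_apply, Complex.inner, Complex.mul_re, Complex.mul_im, map_mul]
  simp
  ring

open scoped Classical in
theorem integral_tracePairing_mul_gaussian (y : mixedSpace F) :
    ∫ x, tracePairing x y * D.gaussian x =
      (canonical F - D).gaussian y * (∫ x, D.gaussian x : ℝ) := by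
  have hdual : (canonical F - D).gaussian y =
      diagGaussian (fun w : {w : InfinitePlace F // w.IsReal} => Real.exp (-2 * D.2 w))⁻¹
        (fun w : {w : InfinitePlace F // w.IsComplex} => 2 * Real.exp (-D.2 w))⁻¹
        (y.1, fun w => 2 * star (y.2 w)) := by
    rw [gaussian_eq_diagGaussian, diagGaussian, diagGaussian]
    congr 4 <;> refine Finset.sum_congr rfl fun w _ => ?_
    · simp [canonical, ← Real.exp_neg]
    · simp [canonical, Real.exp_neg]
      ring
  simp_rw [tracePairing_eq_innerChar]
  rw [hdual, gaussian_eq_diagGaussian, ← integral_complex_ofReal]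
  exact integral_innerChar_mul_diagGaussian (fun _ => Real.exp_pos _) (fun _ => by positivity) _

open scoped Classical in
/-- The isomorphism `x ↦ exp (2 π i Tr (x ·))` of `(I ⊗ ℝ) / I` with the Pontryagin dual of the
lattice of `K - D`. -/
def traceEquiv : (mixedSpace F ⧸ D.lattice) ≃ₜ+ AddDual (canonical F - D).lattice :=
  pairingEquiv traceForm_mixedSpace_nondegenerate (canonical F - D).latticeBasis
    (canonical F - D).lattice_eq_span <| by
      rw [← lattice_canonical_sub, sub_sub_cancel]

theorem traceEquiv_mk_eval (x : mixedSpace F) (y : (canonical F - D).lattice) :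
    (D.traceEquiv x).eval y = tracePairing x y := by
  classical
  rw [traceEquiv, pairingEquiv_mk_eval, tracePairing, Circle.coe_exp, Algebra.traceForm_apply]
  congr 1
  push_cast
  ring

theorem exists_traceEquiv_eval_ne_one {y : (canonical F - D).lattice} (hy : y ≠ 0) :
    ∃ a, (D.traceEquiv a).eval y ≠ 1 := by
  classical
  obtain ⟨x, hx⟩ := exists_pairingHom_eval_ne_one traceForm_mixedSpace_nondegenerate hy
  exact ⟨x, hx⟩

open scoped Classical in
theorem integral_traceEquiv_eval_mul_gaussian (y : (canonical F - D).lattice) :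
    ∫ x : mixedSpace F, (D.traceEquiv x).eval y * D.gaussian x =
      (canonical F - D).effectivity y * (∫ x, D.gaussian x : ℝ) := by
  simp_rw [traceEquiv_mk_eval]
  exact D.integral_tracePairing_mul_gaussian y

theorem integral_traceEquiv_eval_omega (y : (canonical F - D).lattice) :
    ∫ a, (D.traceEquiv a).eval y ∂D.omega = (canonical F - D).effectivity y := by
  classical
  exact D.hasPolynomialDecay_gaussian.integral_eval_quotientMeasure D.latticeBasis D.lattice_eq_span
    D.traceEquiv D.isFirstKind_gaussian.pos D.integral_traceEquiv_eval_mul_gaussian y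

theorem summable_effectivity : Summable D.effectivity := by
  classical
  exact D.hasPolynomialDecay_gaussian.summable D.lattice

theorem isFirstKind_quotientGaussian : IsFirstKind D.quotientGaussian := by
  classical
  exact D.hasPolynomialDecay_gaussian.isFirstKind_quotientFun D.latticeBasis D.lattice_eq_span
    D.traceEquiv D.isFirstKind_gaussian.pos D.integral_traceEquiv_eval_mul_gaussian
    (fun _ => D.exists_traceEquiv_eval_ne_one) (canonical F - D).summable_effectivity
    fun y => ((canonical F - D).isFirstKind_effectivity.pos y).le

theorem isSecondKind_omega : IsSecondKind D.omega := by
  classical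
  exact D.hasPolynomialDecay_gaussian.isSecondKind_quotientMeasure_quotientFun D.latticeBasis
    D.lattice_eq_span D.traceEquiv D.isFirstKind_gaussian.pos
    D.integral_traceEquiv_eval_mul_gaussian
    (fun _ => D.exists_traceEquiv_eval_ne_one) (canonical F - D).summable_effectivity
    fun y => ((canonical F - D).isFirstKind_effectivity.pos y).le

theorem h1IsDefined : D.H1IsDefined where
  hasQuotient :=
    { closed := inferInstance
      firstKind := D.isFirstKind_gaussian
      integrable x := by
        classical
        have : Countable D.lattice := countable_of_Lindelof_of_discrete
        exact integrable_addHaar_of_summable _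
          (D.hasPolynomialDecay_gaussian.summable_add D.lattice x)
      quotient := D.isFirstKind_quotientGaussian }
  finiteDimensional := integrable_of_continuous D.isFirstKind_quotientGaussian.continuous
  secondKind := D.isSecondKind_omega

theorem isFourierTransform_iff (ν : Measure (AddDual (canonical F - D).lattice)) :
    IsFourierTransform (canonical F - D).effectivity ν ↔ ν = D.omega.map D.traceEquiv :=
  have := D.isSecondKind_omega.probability
  isFourierTransform_iff_eq_map D.traceEquiv D.integral_traceEquiv_eval_omega ν

/-- The homeomorphism `x ↦ (y ↦ exp (2 π i Tr (x y)) u y)` from `(I ⊗ ℝ) / I` onto the space of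
symmetric quasi-characters of `H⁰(K - D)`, where `u` is the effectivity of `K - D`. -/
def serreHomeomorph : (mixedSpace F ⧸ D.lattice) ≃ₜ QuasiDual (canonical F - D).H0 :=
  dualHomeomorph D.traceEquiv (canonical F - D).isFirstKind_effectivity

theorem serreHomeomorph_apply (a : mixedSpace F ⧸ D.lattice) (y : (canonical F - D).lattice) :
    (D.serreHomeomorph a).1 y = (D.traceEquiv a).eval y * (canonical F - D).effectivity y :=
  dualHomeomorph_apply D.traceEquiv (canonical F - D).isFirstKind_effectivity a y

theorem isDuality_serreHomeomorph : IsDuality (canonical F - D).H0 D.H1 D.serreHomeomorph :=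
  have := D.isSecondKind_omega.probability
  isDuality_dualHomeomorph D.traceEquiv (canonical F - D).isFirstKind_effectivity
    D.integral_traceEquiv_eval_omega

end ArakelovDivisor

end

/-- Serre duality: for every Arakelov divisor `D` of a number field, `H¹(D)` is the Pontryagin dual
of `H⁰(K - D)`. -/
theorem theorem5p2 {F : Type*} [Field F] [NumberField F] (D : ArakelovDivisor F) :
    -- the ideal of `K - D` is the inverse of the different times the inverse of the ideal of `D`
    (((ArakelovDivisor.canonical F - D).ideal : FractionalIdeal (𝓞 F)⁰ F) =
      (differentIdeal ℤ (𝓞 F) : FractionalIdeal (𝓞 F)⁰ F)⁻¹ *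
        (D.ideal : FractionalIdeal (𝓞 F)⁰ F)⁻¹) ∧
    -- `H⁰(K - D)` is a ghost-space of the first kind, `H¹(D)` one of the second kind
    GhostSpace.IsFirstKind (ArakelovDivisor.canonical F - D).effectivity ∧
    D.H1IsDefined ∧
    -- duality of the underlying groups, through the trace pairing
    ∃ e : (mixedEmbedding.mixedSpace F ⧸ D.lattice) ≃ₜ+
        GhostSpace.AddDual (ArakelovDivisor.canonical F - D).lattice,
      (∀ (x : mixedEmbedding.mixedSpace F) (y : (ArakelovDivisor.canonical F - D).lattice),
        (e x).eval y = ArakelovDivisor.tracePairing x y) ∧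
      -- `ω` corresponds to the Fourier transform of `u`
      (∀ ν : Measure (GhostSpace.AddDual (ArakelovDivisor.canonical F - D).lattice),
        GhostSpace.IsFourierTransform (ArakelovDivisor.canonical F - D).effectivity ν ↔ ν = D.omega.map e) ∧
      -- duality of the convolution structures
      ∃ Φ : (mixedEmbedding.mixedSpace F ⧸ D.lattice) ≃ₜ
          GhostSpace.QuasiDual (ArakelovDivisor.canonical F - D).H0,
        (∀ (a : mixedEmbedding.mixedSpace F ⧸ D.lattice)
            (y : (ArakelovDivisor.canonical F - D).lattice),
          (Φ a).1 y = (e a).eval y * ((ArakelovDivisor.canonical F - D).effectivity y : ℂ)) ∧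
        GhostSpace.IsDuality (ArakelovDivisor.canonical F - D).H0 D.H1 Φ :=
  ⟨D.coe_ideal_canonical_sub, (ArakelovDivisor.canonical F - D).isFirstKind_effectivity,
    D.h1IsDefined, D.traceEquiv, D.traceEquiv_mk_eval, D.isFourierTransform_iff,
    D.serreHomeomorph, D.serreHomeomorph_apply, D.isDuality_serreHomeomorph⟩
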